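/- Let $a,b,c\in\mathbb{R}$ and consider the planar polynomial differential system $$\dot x=-y,\qquad \dot y=x^5+ax^6+y\,(bx^3+cx^4).$$ A singular point $p$ of a planar system is a center if it has a neighborhood $U$ such that all the orbits of $U\setminus\{p\}$ are periodic; a center $p$ is nilpotent if, after an affine change of variables sending $p$ to the origin and a rescaling of the time by a nonzero constant, the system can be written near the origin as $\dot x=y+F_1(x,y)$, $\dot y=F_2(x,y)$, with $F_1,F_2$ real analytic near the origin and without constant and linear terms. Then the system above has a nilpotent center at the origin if and only if $ab=0$ and $c=0$. -/

import Mathlib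

open Filter Topology

namespace PlanarSystem

/-- `γ` is a complete solution of the autonomous planar system `ż = X z`. -/
def IsSolution (X : ℝ × ℝ → ℝ × ℝ) (γ : ℝ → ℝ × ℝ) : Prop :=
  ∀ t : ℝ, HasDerivAt γ (X (γ t)) t

/-- `γ` parametrizes a periodic orbit of `ż = X z`: it is a nonconstant solution, defined for all
times, with some period `T > 0`. -/
def IsPeriodicOrbit (X : ℝ × ℝ → ℝ × ℝ) (γ : ℝ → ℝ × ℝ) : Prop :=
  IsSolution X γ ∧ (∃ t : ℝ, γ t ≠ γ 0) ∧ ∃ T : ℝ, 0 < T ∧ Function.Periodic γ T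

/-- The singular point `p` of `ż = X z` is a center: there is a neighborhood `U` of `p` such that
all the orbits of `U \ {p}` are periodic, that is, through every point of `U \ {p}` there passes a
periodic orbit that lies in `U \ {p}`. -/
def IsCenter (X : ℝ × ℝ → ℝ × ℝ) (p : ℝ × ℝ) : Prop :=
  X p = 0 ∧ ∃ U ∈ 𝓝 p, ∀ q ∈ U \ {p},
    ∃ γ : ℝ → ℝ × ℝ, γ 0 = q ∧ IsPeriodicOrbit X γ ∧ ∀ t : ℝ, γ t ∈ U \ {p}

/-- `F` is a real analytic function near the origin without constant and linear terms. -/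
def IsAnalyticNonlinear (F : ℝ × ℝ → ℝ) : Prop :=
  AnalyticAt ℝ F 0 ∧ F 0 = 0 ∧ fderiv ℝ F 0 = 0

/-- After an affine change of variables `z = e q` sending `p` to the origin and a rescaling
`t = τ s` of the time, the system `dq/dt = X q` is written, near the origin, as
`dx/ds = y + F₁ (x, y)`, `dy/ds = F₂ (x, y)`, where `z = (x, y)` and `F₁`, `F₂` are real analytic
without constant and linear terms. -/
def HasNilpotentForm (X : ℝ × ℝ → ℝ × ℝ) (p : ℝ × ℝ) : Prop :=
  ∃ (e : (ℝ × ℝ) ≃ᵃ[ℝ] (ℝ × ℝ)) (τ : ℝ) (F₁ F₂ : ℝ × ℝ → ℝ),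
    e p = 0 ∧ τ ≠ 0 ∧ IsAnalyticNonlinear F₁ ∧ IsAnalyticNonlinear F₂ ∧
    ∀ᶠ z in 𝓝 (0 : ℝ × ℝ), τ • e.linear (X (e.symm z)) = (z.2 + F₁ z, F₂ z)

/-- `p` is a nilpotent center of the system `ż = X z`. -/
def IsNilpotentCenter (X : ℝ × ℝ → ℝ × ℝ) (p : ℝ × ℝ) : Prop :=
  IsCenter X p ∧ HasNilpotentForm X p

/-- The system `ẋ = -y`, `ẏ = x⁵ + a x⁶ + y (b x³ + c x⁴)`. -/
def quinticSystem (a b c : ℝ) : ℝ × ℝ → ℝ × ℝ := fun z =>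
  (-z.2, z.1 ^ 5 + a * z.1 ^ 6 + z.2 * (b * z.1 ^ 3 + c * z.1 ^ 4))

end PlanarSystem

namespace PlanarSystem

/-- The restoring force `x⁵ + a x⁶` of the Liénard system. -/
def force (a x : ℝ) : ℝ := x ^ 5 * (1 + a * x)

/-- The primitive of `x⁵ + a x⁶` vanishing at `0`. -/
noncomputable def potential (a x : ℝ) : ℝ := x ^ 6 * (1 / 6 + a * x / 7)

/-- The primitive of `b x³ + c x⁴` vanishing at `0`. -/
noncomputable def damping (b c x : ℝ) : ℝ := x ^ 4 * (b / 4 + c * x / 5)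

/-- The energy in the Liénard plane. -/
noncomputable def energy (a x w : ℝ) : ℝ := w ^ 2 / 2 + potential a x

/-- `x`, `w` solve `ẋ = F(x) - w`, `ẇ = g(x)` as long as they stay in the square of radius `η`. -/
structure IsLienardOn (a b c η : ℝ) (x w : ℝ → ℝ) : Prop where
  contX : Continuous x
  contW : Continuous w
  derivX : ∀ t, |x t| ≤ η → |w t| ≤ η → HasDerivAt x (damping b c (x t) - w t) t
  derivW : ∀ t, |x t| ≤ η → |w t| ≤ η → HasDerivAt w (force a (x t)) t

/-- `η` is small with respect to the coefficients. -/
structure IsSmall (a b c η : ℝ) : Prop where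
  pos : 0 < η
  le_one : η ≤ 1
  left : |a| * η ≤ 1 / 2
  right : 192 * (|b| + |c|) * η ≤ 1

theorem le_of_hasDerivAt_nonneg {f f' : ℝ → ℝ} {p q : ℝ} (hpq : p ≤ q)
    (hc : ContinuousOn f (Set.Icc p q)) (hf : ∀ t ∈ Set.Ioo p q, HasDerivAt f (f' t) t)
    (h0 : ∀ t ∈ Set.Ioo p q, 0 ≤ f' t) : f p ≤ f q := by
  have := monotoneOn_of_deriv_nonneg (convex_Icc p q) hc
    (fun t ht => by
      rw [interior_Icc] at ht ⊢
      exact (hf t ht).differentiableAt.differentiableWithinAt)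
    (fun t ht => by
      rw [interior_Icc] at ht
      rw [(hf t ht).deriv]
      exact h0 t ht)
  exact this (Set.left_mem_Icc.2 hpq) (Set.right_mem_Icc.2 hpq) hpq

/-- One-sided Grönwall estimate. -/
theorem nonpos_of_deriv_le_mul_abs {f f' : ℝ → ℝ} {K p q : ℝ}
    (hc : ContinuousOn f (Set.Icc p q)) (hf : ∀ t ∈ Set.Ioo p q, HasDerivAt f (f' t) t)
    (hK : ∀ t ∈ Set.Ioo p q, f' t ≤ K * |f t|) (hp : f p ≤ 0) :
    ∀ t ∈ Set.Icc p q, f t ≤ 0 := by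
  intro ξ hξ
  by_contra! hpos
  let S := Set.Icc p ξ ∩ f ⁻¹' Set.Iic 0
  have hcξ : ContinuousOn f (Set.Icc p ξ) := hc.mono (Set.Icc_subset_Icc le_rfl hξ.2)
  have hS : IsCompact S :=
    isCompact_Icc.of_isClosed_subset (hcξ.preimage_isClosed_of_isClosed isClosed_Icc isClosed_Iic)
      Set.inter_subset_left
  obtain ⟨m, hm, hmax⟩ := hS.exists_isGreatest ⟨p, ⟨le_rfl, hξ.1⟩, hp⟩
  have hmξ : m < ξ := lt_of_le_of_ne hm.1.2 (by
    rintro rfl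
    exact absurd hm.2 (not_le.2 hpos))
  have hfpos : ∀ t ∈ Set.Ioo m ξ, 0 < f t := by
    intro t ht
    by_contra! hle
    exact absurd (hmax ⟨⟨hm.1.1.trans ht.1.le, ht.2.le⟩, hle⟩) (not_le.2 ht.1)
  have hsub : ∀ t ∈ Set.Ioo m ξ, t ∈ Set.Ioo p q :=
    fun t ht => ⟨hm.1.1.trans_lt ht.1, ht.2.trans_le hξ.2⟩
  have key := le_of_hasDerivAt_nonneg (f := fun t => -(f t * Real.exp (-K * t)))
    (f' := fun t => -(f' t * Real.exp (-K * t) + f t * (Real.exp (-K * t) * (-K)))) hmξ.le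
    (((hcξ.mono (Set.Icc_subset_Icc hm.1.1 le_rfl)).mul (by fun_prop)).neg)
    (fun t ht => by
      have h1 : HasDerivAt (fun t : ℝ => Real.exp (-K * t)) (Real.exp (-K * t) * (-K)) t := by
        simpa using ((hasDerivAt_id t).const_mul (-K)).exp
      exact ((hf t (hsub t ht)).mul h1).neg)
    (fun t ht => by
      have h1 := hK t (hsub t ht)
      rw [abs_of_pos (hfpos t ht)] at h1
      have h2 := Real.exp_pos (-K * t)
      nlinarith)
  have h1 : 0 < f ξ * Real.exp (-K * ξ) := mul_pos hpos (Real.exp_pos _)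
  have h2 : f m * Real.exp (-K * m) ≤ 0 :=
    mul_nonpos_of_nonpos_of_nonneg hm.2 (Real.exp_pos _).le
  linarith

/-- Two-sided consequence of the one-sided Grönwall estimate. -/
theorem eq_zero_of_deriv_le_mul_abs {f f' : ℝ → ℝ} {K p q : ℝ}
    (hc : ContinuousOn f (Set.Icc p q)) (hf : ∀ t ∈ Set.Ioo p q, HasDerivAt f (f' t) t)
    (hK : ∀ t ∈ Set.Ioo p q, f' t ≤ K * |f t|) (hp : f p ≤ 0) (hq : 0 ≤ f q) :
    ∀ t ∈ Set.Icc p q, f t = 0 := by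
  have h1 := nonpos_of_deriv_le_mul_abs hc hf hK hp
  have h2 := nonpos_of_deriv_le_mul_abs (f := fun t => -f (p + q - t))
    (f' := fun t => f' (p + q - t)) (K := K) (p := p) (q := q)
    ((hc.comp (by fun_prop) (fun t ht => ⟨by linarith [ht.2], by linarith [ht.1]⟩)).neg)
    (fun t ht => by
      have := (hf (p + q - t) ⟨by linarith [ht.2], by linarith [ht.1]⟩).comp_const_sub (p + q) t
      exact this.neg.congr_deriv (by simp))
    (fun t ht => by
      simpa using hK (p + q - t) ⟨by linarith [ht.2], by linarith [ht.1]⟩)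
    (by simpa using hq)
  intro t ht
  refine le_antisymm (h1 t ht) ?_
  have := h2 (p + q - t) ⟨by linarith [ht.2], by linarith [ht.1]⟩
  simp only [sub_sub_cancel] at this
  linarith

section Estimates

variable {a b c η : ℝ}

theorem IsSmall.abs_mul_le (h : IsSmall a b c η) {x : ℝ} (hx : |x| ≤ η) : |a * x| ≤ 1 / 2 := by
  rw [abs_mul]
  exact (mul_le_mul_of_nonneg_left hx (abs_nonneg a)).trans h.left

theorem IsSmall.potential_ge (h : IsSmall a b c η) {x : ℝ} (hx : |x| ≤ η) :
    x ^ 6 / 12 ≤ potential a x := by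
  have h1 := abs_le.1 (h.abs_mul_le hx)
  have h2 : 0 ≤ x ^ 6 := by positivity
  unfold potential
  nlinarith

theorem IsSmall.potential_le (h : IsSmall a b c η) {x : ℝ} (hx : |x| ≤ η) :
    potential a x ≤ x ^ 6 / 4 := by
  have h1 := abs_le.1 (h.abs_mul_le hx)
  have h2 : 0 ≤ x ^ 6 := by positivity
  unfold potential
  nlinarith

theorem IsSmall.force_ge (h : IsSmall a b c η) {x : ℝ} (hx : |x| ≤ η) (h0 : 0 ≤ x) :
    x ^ 5 / 2 ≤ force a x := by
  have h1 := abs_le.1 (h.abs_mul_le hx)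
  have h2 : 0 ≤ x ^ 5 := by positivity
  unfold force
  nlinarith

theorem IsSmall.force_le (h : IsSmall a b c η) {x : ℝ} (hx : |x| ≤ η) (h0 : 0 ≤ x) :
    force a x ≤ 2 * x ^ 5 := by
  have h1 := abs_le.1 (h.abs_mul_le hx)
  have h2 : 0 ≤ x ^ 5 := by positivity
  unfold force
  nlinarith

theorem IsSmall.force_neg (h : IsSmall a b c η) {x : ℝ} (hx : |x| ≤ η) (h0 : x < 0) :
    force a x < 0 := by
  have h1 := abs_le.1 (h.abs_mul_le hx)
  have h2 : x ^ 5 < 0 := Odd.pow_neg (by decide) h0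
  unfold force
  nlinarith

theorem IsSmall.abs_damping_le (h : IsSmall a b c η) {x : ℝ} (hx : |x| ≤ η) :
    |damping b c x| ≤ (|b| + |c|) * x ^ 4 := by
  have h1 : |x| ≤ 1 := hx.trans h.le_one
  have h2 : 0 ≤ x ^ 4 := by positivity
  unfold damping
  rw [abs_mul, abs_of_nonneg h2, mul_comm]
  refine mul_le_mul_of_nonneg_right ?_ h2
  have h3 : |c * x| ≤ |c| := by
    rw [abs_mul]
    exact mul_le_of_le_one_right (abs_nonneg c) h1
  have := abs_add_le (b / 4) (c * x / 5)
  rw [abs_div, abs_div, abs_of_pos (by norm_num : (0:ℝ) < 4),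
    abs_of_pos (by norm_num : (0:ℝ) < 5)] at this
  linarith [abs_nonneg b, abs_nonneg c]

theorem hasDerivAt_damping (b c x : ℝ) :
    HasDerivAt (damping b c) (b * x ^ 3 + c * x ^ 4) x := by
  have h1 := (hasDerivAt_pow 4 x).mul (((hasDerivAt_id x).const_mul (c / 5)).const_add (b / 4))
  refine (h1.congr_deriv ?_).congr_of_eventuallyEq (Eventually.of_forall fun t => ?_)
  · simp; ring
  · simp only [damping, Pi.mul_apply, id]; ring

theorem hasDerivAt_potential (a x : ℝ) : HasDerivAt (potential a) (force a x) x := by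
  have h1 := (hasDerivAt_pow 6 x).mul (((hasDerivAt_id x).const_mul (a / 7)).const_add (1 / 6))
  refine (h1.congr_deriv ?_).congr_of_eventuallyEq (Eventually.of_forall fun t => ?_)
  · simp [force]; ring
  · simp only [potential, Pi.mul_apply, id]; ring

theorem IsLienardOn.hasDerivAt_energy {x w : ℝ → ℝ} (h : IsLienardOn a b c η x w) {t : ℝ}
    (hx : |x t| ≤ η) (hw : |w t| ≤ η) :
    HasDerivAt (fun t => energy a (x t) (w t)) (force a (x t) * damping b c (x t)) t := by
  have h1 := (((h.derivW t hx hw).pow 2).div_const 2).add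
    ((hasDerivAt_potential a (x t)).comp t (h.derivX t hx hw))
  refine (h1.congr_deriv ?_).congr_of_eventuallyEq (Eventually.of_forall fun t => ?_)
  · simp; ring
  · simp [energy]

theorem IsLienardOn.continuous_energy {x w : ℝ → ℝ} (h : IsLienardOn a b c η x w) :
    Continuous (fun t => energy a (x t) (w t)) := by
  have := h.contX
  have := h.contW
  unfold energy potential
  fun_prop

/-- Points of energy at most `4 r⁶` lie well inside the square. -/
theorem IsSmall.bounds_of_energy_le (h : IsSmall a b c η) {x w r : ℝ} (hr : 0 < r)
    (hx : |x| ≤ η) (hE : energy a x w ≤ 4 * r ^ 6) : |x| ≤ 2 * r ∧ |w| ≤ 3 * r ^ 3 := by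
  have h1 := h.potential_ge hx
  have h2 : 0 ≤ x ^ 6 := by positivity
  unfold energy at hE
  constructor
  · refine (pow_le_pow_iff_left₀ (abs_nonneg x) (by positivity) (by norm_num : 6 ≠ 0)).1 ?_
    have h3 : |x| ^ 6 = x ^ 6 := (Even.pow_abs (by decide) x)
    rw [h3, mul_pow]
    have : 0 < r ^ 6 := by positivity
    nlinarith [sq_nonneg w]
  · refine abs_le_of_sq_le_sq ?_ (by positivity)
    nlinarith [pow_pos hr 6]

/-- A priori estimate of the energy along an arc in the right half plane. -/
theorem IsLienardOn.energy_estimate {x w : ℝ → ℝ} (h : IsLienardOn a b c η x w)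
    (hη : IsSmall a b c η) {r t₀ t₁ : ℝ} (hr : 0 < r) (hrη : r ≤ η / 4) (ht : t₀ ≤ t₁)
    (hE : energy a (x t₀) (w t₀) = r ^ 6)
    (hbox : ∀ t ∈ Set.Icc t₀ t₁, 0 ≤ x t ∧ |x t| ≤ η ∧ |w t| ≤ η ∧
      energy a (x t) (w t) ≤ 4 * r ^ 6) :
    r ^ 6 / 2 ≤ energy a (x t₁) (w t₁) ∧ energy a (x t₁) (w t₁) ≤ 2 * r ^ 6 := by
  set C := |b| + |c| with hC
  have hC0 : 0 ≤ C := by positivity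
  have hF : ∀ t ∈ Set.Icc t₀ t₁, |damping b c (x t)| ≤ 16 * C * r ^ 4 := by
    intro t ht
    obtain ⟨h0, hx, hw, hEt⟩ := hbox t ht
    refine (hη.abs_damping_le hx).trans ?_
    have h1 := (hη.bounds_of_energy_le hr hx hEt).1
    have h2 : x t ^ 4 ≤ (2 * r) ^ 4 := by
      rw [← Even.pow_abs (by decide : Even 4)]
      exact pow_le_pow_left₀ (abs_nonneg _) h1 4
    calc C * x t ^ 4 ≤ C * (2 * r) ^ 4 := mul_le_mul_of_nonneg_left h2 hC0
      _ = 16 * C * r ^ 4 := by ring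
  have hw : ∀ t ∈ Set.Icc t₀ t₁, |w t| ≤ 3 * r ^ 3 := fun t ht =>
    (hη.bounds_of_energy_le hr (hbox t ht).2.1 (hbox t ht).2.2.2).2
  have hg : ∀ t ∈ Set.Icc t₀ t₁, 0 ≤ force a (x t) := fun t ht =>
    le_trans (by have := (hbox t ht).1; positivity) (hη.force_ge (hbox t ht).2.1 (hbox t ht).1)
  have hdE : ∀ t ∈ Set.Ioo t₀ t₁, HasDerivAt (fun t => energy a (x t) (w t))
      (force a (x t) * damping b c (x t)) t := fun t ht =>
    h.hasDerivAt_energy (hbox t (Set.Ioo_subset_Icc_self ht)).2.1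
      (hbox t (Set.Ioo_subset_Icc_self ht)).2.2.1
  have hdw : ∀ t ∈ Set.Ioo t₀ t₁, HasDerivAt (fun t => 16 * C * r ^ 4 * w t)
      (16 * C * r ^ 4 * force a (x t)) t := fun t ht =>
    (h.derivW t (hbox t (Set.Ioo_subset_Icc_self ht)).2.1
      (hbox t (Set.Ioo_subset_Icc_self ht)).2.2.1).const_mul _
  have cE := h.continuous_energy
  have cW : Continuous fun t => 16 * C * r ^ 4 * w t := continuous_const.mul h.contW
  have k1 := le_of_hasDerivAt_nonneg ht (cE.add cW).continuousOn
    (fun t ht => (hdE t ht).add (hdw t ht)) (fun t ht => by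
      have h1 := abs_le.1 (hF t (Set.Ioo_subset_Icc_self ht))
      have h2 := hg t (Set.Ioo_subset_Icc_self ht)
      nlinarith)
  have k2 := le_of_hasDerivAt_nonneg ht (cW.sub cE).continuousOn
    (fun t ht => (hdw t ht).sub (hdE t ht)) (fun t ht => by
      have h1 := abs_le.1 (hF t (Set.Ioo_subset_Icc_self ht))
      have h2 := hg t (Set.Ioo_subset_Icc_self ht)
      nlinarith)
  simp only [Pi.add_apply, Pi.sub_apply] at k1 k2
  rw [hE] at k1 k2
  have w0 := abs_le.1 (hw t₀ (Set.left_mem_Icc.2 ht))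
  have w1 := abs_le.1 (hw t₁ (Set.right_mem_Icc.2 ht))
  have hr4 : 0 ≤ 16 * C * r ^ 4 := by positivity
  have hCr : 192 * C * r ≤ 1 := by
    refine le_trans ?_ hη.right
    exact mul_le_mul_of_nonneg_left (by linarith [hη.pos]) (by positivity)
  have hd : 16 * C * r ^ 4 * (w t₁ - w t₀) ≤ r ^ 6 / 2 := by
    calc 16 * C * r ^ 4 * (w t₁ - w t₀) ≤ 16 * C * r ^ 4 * (6 * r ^ 3) :=
          mul_le_mul_of_nonneg_left (by linarith) hr4
      _ = (192 * C * r) * (r ^ 6 / 2) := by ring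
      _ ≤ 1 * (r ^ 6 / 2) := mul_le_mul_of_nonneg_right hCr (by positivity)
      _ = r ^ 6 / 2 := one_mul _
  constructor <;> nlinarith [pow_pos hr 6]

end Estimates

theorem eventually_lt_right_of_deriv_pos {f : ℝ → ℝ} {f' t₀ : ℝ} (hf : HasDerivAt f f' t₀)
    (h : 0 < f') : ∀ᶠ t in 𝓝[>] t₀, f t₀ < f t := by
  have h1 := (hasDerivAt_iff_tendsto_slope.1 hf).eventually (lt_mem_nhds h)
  have h2 : 𝓝[>] t₀ ≤ 𝓝[≠] t₀ := nhdsWithin_mono _ fun t ht => ne_of_gt ht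
  filter_upwards [h2 h1, self_mem_nhdsWithin] with t ht htt
  have htt : t₀ < t := htt
  rw [slope_def_field, div_pos_iff_of_pos_right (sub_pos.2 htt)] at ht
  linarith

theorem deriv_nonpos_of_pos_left {f : ℝ → ℝ} {f' t₀ t₁ : ℝ} (hf : HasDerivAt f f' t₁)
    (ht : t₀ < t₁) (h1 : f t₁ = 0) (h : ∀ t ∈ Set.Ioo t₀ t₁, 0 < f t) : f' ≤ 0 := by
  have h2 : 𝓝[<] t₁ ≤ 𝓝[≠] t₁ := nhdsWithin_mono _ fun t ht => ne_of_lt ht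
  refine le_of_tendsto ((hasDerivAt_iff_tendsto_slope.1 hf).mono_left h2) ?_
  filter_upwards [Ioo_mem_nhdsLT ht] with t htt
  rw [slope_def_field, h1]
  have := h t htt
  exact div_nonpos_of_nonneg_of_nonpos (by linarith) (by linarith [htt.2])

theorem damping_zero (b c : ℝ) : damping b c 0 = 0 := by simp [damping]

theorem potential_zero (a : ℝ) : potential a 0 = 0 := by simp [potential]

theorem energy_zero_left (a w : ℝ) : energy a 0 w = w ^ 2 / 2 := by
  simp [energy, potential_zero]

/-- A solution confined to a small energy shell leaves the right half plane in finite time. -/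
theorem IsLienardOn.not_forall_confined {a b c η : ℝ} {x w : ℝ → ℝ}
    (h : IsLienardOn a b c η x w) (hη : IsSmall a b c η) {m t₀ : ℝ} (hm : 0 < m)
    (hbox : ∀ t, t₀ ≤ t → 0 ≤ x t ∧ |x t| ≤ η ∧ |w t| ≤ η ∧ m ≤ energy a (x t) (w t)) :
    False := by
  set C := |b| + |c| with hC
  have hC0 : 0 ≤ C := by positivity
  have hC1 : ∀ t, t₀ ≤ t → |damping b c (x t)| ≤ C * x t ^ 4 := fun t ht =>
    hη.abs_damping_le (hbox t ht).2.1
  set K := C ^ 2 + 3 with hK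
  have key : ∀ s, 0 ≤ s → m * s ≤ 2 * (K + 1) := by
    intro s hs
    have cΦ : Continuous fun t => K * w t - x t * w t - m * t :=
      ((continuous_const.mul h.contW).sub (h.contX.mul h.contW)).sub
        (continuous_const.mul continuous_id)
    have := le_of_hasDerivAt_nonneg (f := fun t => K * w t - x t * w t - m * t)
      (f' := fun t => K * force a (x t) -
        ((damping b c (x t) - w t) * w t + x t * force a (x t)) - m * 1)
      (p := t₀) (q := t₀ + s) (by linarith) cΦ.continuousOn
      (fun t ht => by
        obtain ⟨_, hx, hw, _⟩ := hbox t ht.1.le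
        exact (((h.derivW t hx hw).const_mul K).sub
          ((h.derivX t hx hw).mul (h.derivW t hx hw))).sub ((hasDerivAt_id t).const_mul m))
      (fun t ht => by
        obtain ⟨h0, hx, hw, hE⟩ := hbox t ht.1.le
        have hd := hC1 t ht.1.le
        have hg := hη.force_ge hx h0
        have hG := hη.potential_le hx
        have hx1 : x t ≤ 1 := (le_abs_self _).trans (hx.trans hη.le_one)
        unfold energy at hE
        have h5 : 0 ≤ x t ^ 5 := by positivity
        have e1 : x t ^ 6 ≤ x t ^ 5 := by
          have : x t ^ 6 = x t ^ 5 * x t := by ring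
          rw [this]; exact mul_le_of_le_one_right h5 hx1
        have e2 : damping b c (x t) ^ 2 ≤ C ^ 2 * x t ^ 5 := by
          calc damping b c (x t) ^ 2 = |damping b c (x t)| ^ 2 := (sq_abs _).symm
            _ ≤ (C * x t ^ 4) ^ 2 := pow_le_pow_left₀ (abs_nonneg _) hd 2
            _ = C ^ 2 * x t ^ 5 * x t ^ 3 := by ring
            _ ≤ C ^ 2 * x t ^ 5 * 1 :=
              mul_le_mul_of_nonneg_left (pow_le_one₀ h0 hx1) (by positivity)
            _ = C ^ 2 * x t ^ 5 := mul_one _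
        have e3 : (C ^ 2 + 2) * (x t ^ 5 / 2) ≤ (K - x t) * force a (x t) :=
          mul_le_mul (by rw [hK]; linarith) hg (by positivity)
            (by rw [hK]; nlinarith [sq_nonneg C])
        nlinarith [sq_nonneg (damping b c (x t) - w t)])
    obtain ⟨_, hx0, hw0, _⟩ := hbox t₀ le_rfl
    obtain ⟨_, hx1, hw1, _⟩ := hbox (t₀ + s) (by linarith)
    have hK0 : 0 ≤ K := by positivity
    have bd : ∀ u v : ℝ, |u| ≤ η → |v| ≤ η → |K * v - u * v| ≤ K + 1 := by
      intro u v hu hv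
      have hu1 := hu.trans hη.le_one
      have hv1 := hv.trans hη.le_one
      calc |K * v - u * v| ≤ |K * v| + |u * v| := abs_sub _ _
        _ = K * |v| + |u| * |v| := by rw [abs_mul, abs_mul, abs_of_nonneg hK0]
        _ ≤ K * 1 + 1 * 1 := add_le_add (mul_le_mul_of_nonneg_left hv1 hK0)
            (mul_le_mul hu1 hv1 (abs_nonneg _) zero_le_one)
        _ = K + 1 := by ring
    have b0 := abs_le.1 (bd _ _ hx0 hw0)
    have b1 := abs_le.1 (bd _ _ hx1 hw1)
    nlinarith [b0.1, b1.2]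
  have hK0 : 0 ≤ K := by positivity
  have := key ((2 * (K + 1) + 1) / m) (by positivity)
  rw [mul_div_cancel₀ _ hm.ne'] at this
  linarith

/-- Small solutions starting in the right half plane reach the positive vertical axis. -/
theorem IsLienardOn.exists_right_arc {a b c η : ℝ} {x w : ℝ → ℝ}
    (h : IsLienardOn a b c η x w) (hη : IsSmall a b c η) {r t₀ : ℝ} (hr : 0 < r)
    (hrη : r ≤ η / 4) (hx₀ : |x t₀| ≤ η) (hE : energy a (x t₀) (w t₀) = r ^ 6)
    (h₀ : 0 < x t₀ ∨ x t₀ = 0 ∧ w t₀ < 0) :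
    ∃ t₁, t₀ < t₁ ∧ (∀ t ∈ Set.Ioo t₀ t₁, 0 < x t) ∧ x t₁ = 0 ∧ 0 < w t₁ ∧
      ∀ t ∈ Set.Icc t₀ t₁, |x t| ≤ η ∧ |w t| ≤ η ∧
        r ^ 6 / 2 ≤ energy a (x t) (w t) ∧ energy a (x t) (w t) ≤ 2 * r ^ 6 := by
  have hr6 : 0 < r ^ 6 := by positivity
  have small : ∀ u v : ℝ, |u| ≤ η → energy a u v ≤ 4 * r ^ 6 → |u| < η ∧ |v| < η := by
    intro u v hu hE
    obtain ⟨h1, h2⟩ := hη.bounds_of_energy_le hr hu hE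
    have hη0 := hη.pos
    have hη1 := hη.le_one
    have h3 : r ^ 2 ≤ 1 / 16 := by nlinarith
    refine ⟨by linarith, h2.trans_lt ?_⟩
    nlinarith
  let P : Set ℝ := {t | 0 < x t ∧ |x t| < η ∧ |w t| < η ∧ energy a (x t) (w t) < 4 * r ^ 6}
  have oP : IsOpen P :=
    (isOpen_lt continuous_const h.contX).inter ((isOpen_lt h.contX.abs continuous_const).inter
      ((isOpen_lt h.contW.abs continuous_const).inter
        (isOpen_lt h.continuous_energy continuous_const)))
  have hs₀ := small _ _ hx₀ (by linarith : energy a (x t₀) (w t₀) ≤ 4 * r ^ 6)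
  have hstart : ∀ᶠ t in 𝓝[>] t₀, t ∈ P := by
    have hx1 : ∀ᶠ t in 𝓝[>] t₀, 0 < x t := by
      rcases h₀ with h0 | ⟨h0, hw⟩
      · exact nhdsWithin_le_nhds (h.contX.continuousAt.eventually (lt_mem_nhds h0))
      · have := eventually_lt_right_of_deriv_pos (h.derivX t₀ hs₀.1.le hs₀.2.le)
          (by rw [h0, damping_zero]; linarith)
        rwa [h0] at this
    filter_upwards [hx1,
      nhdsWithin_le_nhds (h.contX.abs.continuousAt.eventually (gt_mem_nhds hs₀.1)),
      nhdsWithin_le_nhds (h.contW.abs.continuousAt.eventually (gt_mem_nhds hs₀.2)),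
      nhdsWithin_le_nhds (h.continuous_energy.continuousAt.eventually
        (gt_mem_nhds (by linarith : energy a (x t₀) (w t₀) < 4 * r ^ 6)))] with t h1 h2 h3 h4
    exact ⟨h1, h2, h3, h4⟩
  have hx₀' : 0 ≤ x t₀ := by rcases h₀ with h0 | ⟨h0, _⟩ <;> linarith
  have estimate : ∀ t₁, t₀ ≤ t₁ → (∀ t ∈ Set.Ioo t₀ t₁, t ∈ P) → ∀ t ∈ Set.Icc t₀ t₁,
      0 ≤ x t ∧ |x t| < η ∧ |w t| < η ∧
        r ^ 6 / 2 ≤ energy a (x t) (w t) ∧ energy a (x t) (w t) ≤ 2 * r ^ 6 := by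
    intro t₁ ht₁ hP
    have hcl : ∀ t ∈ Set.Icc t₀ t₁, 0 ≤ x t ∧ |x t| ≤ η ∧ |w t| ≤ η ∧
        energy a (x t) (w t) ≤ 4 * r ^ 6 := by
      rcases ht₁.eq_or_lt with rfl | hlt
      · intro t ht
        obtain rfl : t = t₀ := le_antisymm ht.2 ht.1
        exact ⟨hx₀', hs₀.1.le, hs₀.2.le, by linarith⟩
      · intro t ht
        rw [← closure_Ioo hlt.ne] at ht
        have hclosed : IsClosed {t | 0 ≤ x t ∧ |x t| ≤ η ∧ |w t| ≤ η ∧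
            energy a (x t) (w t) ≤ 4 * r ^ 6} :=
          (isClosed_le continuous_const h.contX).inter
            ((isClosed_le h.contX.abs continuous_const).inter
            ((isClosed_le h.contW.abs continuous_const).inter
              (isClosed_le h.continuous_energy continuous_const)))
        refine closure_minimal ?_ hclosed ht
        intro u hu
        obtain ⟨h1, h2, h3, h4⟩ := hP u hu
        exact ⟨h1.le, h2.le, h3.le, h4.le⟩
    intro t ht
    have he := h.energy_estimate hη hr hrη ht.1 hE
      (fun u hu => hcl u ⟨hu.1, hu.2.trans ht.2⟩)
    obtain ⟨h1, h2, h3, h4⟩ := hcl t ht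
    exact ⟨h1, (small _ _ h2 h4).1, (small _ _ h2 h4).2, he⟩
  obtain ⟨u₀, hu₀, hu₀P⟩ := (mem_nhdsGT_iff_exists_Ioo_subset).1 hstart
  have hu₀ : t₀ < u₀ := hu₀
  have hexit : ∃ t, u₀ ≤ t ∧ t ∉ P := by
    by_contra! hall
    have hP : ∀ t, t₀ < t → t ∈ P := fun t ht => by
      rcases lt_or_ge t u₀ with h1 | h1
      · exact hu₀P ⟨ht, h1⟩
      · exact hall t h1
    refine h.not_forall_confined hη (m := r ^ 6 / 2) (t₀ := t₀) (by positivity) fun t ht => ?_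
    obtain ⟨h1, h2, h3, h4, _⟩ :=
      estimate t ht (fun s hs => hP s hs.1) t (Set.right_mem_Icc.2 ht)
    exact ⟨h1, h2.le, h3.le, h4⟩
  let B : Set ℝ := Set.Ici u₀ ∩ Pᶜ
  have hB : IsClosed B := isClosed_Ici.inter oP.isClosed_compl
  have hBne : B.Nonempty := hexit
  have hBb : BddBelow B := ⟨u₀, fun t ht => ht.1⟩
  have hmem : sInf B ∈ B := hB.csInf_mem hBne hBb
  set t₁ := sInf B with ht₁
  have h01 : t₀ < t₁ := hu₀.trans_le hmem.1
  have hP : ∀ t ∈ Set.Ioo t₀ t₁, t ∈ P := by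
    intro t ht
    rcases lt_or_ge t u₀ with h1 | h1
    · exact hu₀P ⟨ht.1, h1⟩
    · by_contra hn
      exact absurd (csInf_le hBb (⟨h1, hn⟩ : t ∈ B)) (not_le.2 ht.2)
  have hest := estimate t₁ h01.le hP
  obtain ⟨e1, e2, e3, e4, e5⟩ := hest t₁ (Set.right_mem_Icc.2 h01.le)
  have hx1 : x t₁ = 0 := by
    by_contra hne
    exact hmem.2 ⟨lt_of_le_of_ne e1 (Ne.symm hne), e2, e3, by linarith⟩
  refine ⟨t₁, h01, fun t ht => (hP t ht).1, hx1, ?_, fun t ht => ?_⟩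
  · have hd := deriv_nonpos_of_pos_left (h.derivX t₁ e2.le e3.le) h01 hx1
      fun t ht => (hP t ht).1
    rw [hx1, damping_zero] at hd
    rw [hx1, energy_zero_left] at e4
    rcases lt_or_eq_of_le (by linarith : 0 ≤ w t₁) with h1 | h1
    · exact h1
    · rw [← h1] at e4
      nlinarith
  · obtain ⟨_, f2, f3, f4, f5⟩ := hest t ht
    exact ⟨f2.le, f3.le, f4, f5⟩

theorem IsSmall.neg_left {a b c η : ℝ} (h : IsSmall a b c η) : IsSmall (-a) b c η :=
  ⟨h.pos, h.le_one, by rw [abs_neg]; exact h.left, h.right⟩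

theorem IsSmall.neg_mid {a b c η : ℝ} (h : IsSmall a b c η) : IsSmall a (-b) c η :=
  ⟨h.pos, h.le_one, h.left, by rw [abs_neg]; exact h.right⟩

theorem IsSmall.neg_right {a b c η : ℝ} (h : IsSmall a b c η) : IsSmall a b (-c) η :=
  ⟨h.pos, h.le_one, h.left, by rw [abs_neg]; exact h.right⟩

theorem force_neg_neg (a x : ℝ) : force (-a) (-x) = -force a x := by unfold force; ring

theorem potential_neg_neg (a x : ℝ) : potential (-a) (-x) = potential a x := by
  unfold potential; ring

theorem energy_neg_neg (a x w : ℝ) : energy (-a) (-x) (-w) = energy a x w := by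
  simp [energy, potential_neg_neg]

theorem damping_neg_mid (b c x : ℝ) : damping (-b) c (-x) = -damping b c x := by
  unfold damping; ring

theorem damping_neg_right (b c x : ℝ) : damping b (-c) (-x) = damping b c x := by
  unfold damping; ring

/-- The rotation by a half-turn. -/
theorem IsLienardOn.neg {a b c η : ℝ} {x w : ℝ → ℝ} (h : IsLienardOn a b c η x w) :
    IsLienardOn (-a) (-b) c η (fun t => -x t) (fun t => -w t) where
  contX := h.contX.neg
  contW := h.contW.neg
  derivX t hx hw := by
    rw [abs_neg] at hx hw
    exact (h.derivX t hx hw).neg.congr_deriv (by rw [damping_neg_mid]; ring)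
  derivW t hx hw := by
    rw [abs_neg] at hx hw
    exact (h.derivW t hx hw).neg.congr_deriv (by rw [force_neg_neg])

/-- The reflection in the vertical axis, combined with time reversal. -/
theorem IsLienardOn.reflect {a b c η : ℝ} {x w : ℝ → ℝ} (h : IsLienardOn a b c η x w) :
    IsLienardOn (-a) b (-c) η (fun t => -x (-t)) (fun t => w (-t)) where
  contX := (h.contX.comp continuous_neg).neg
  contW := h.contW.comp continuous_neg
  derivX t hx hw := by
    rw [abs_neg] at hx
    have := ((h.derivX (-t) hx hw).comp t (hasDerivAt_neg t)).neg
    exact this.congr_deriv (by rw [damping_neg_right]; ring)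
  derivW t hx hw := by
    rw [abs_neg] at hx
    have := (h.derivW (-t) hx hw).comp t (hasDerivAt_neg t)
    exact this.congr_deriv (by rw [force_neg_neg]; ring)

/-- Small solutions starting in the left half plane reach the negative vertical axis. -/
theorem IsLienardOn.exists_left_arc {a b c η : ℝ} {x w : ℝ → ℝ}
    (h : IsLienardOn a b c η x w) (hη : IsSmall a b c η) {r t₀ : ℝ} (hr : 0 < r)
    (hrη : r ≤ η / 4) (hx₀ : |x t₀| ≤ η) (hE : energy a (x t₀) (w t₀) = r ^ 6)
    (h₀ : x t₀ < 0 ∨ x t₀ = 0 ∧ 0 < w t₀) :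
    ∃ t₁, t₀ < t₁ ∧ (∀ t ∈ Set.Ioo t₀ t₁, x t < 0) ∧ x t₁ = 0 ∧ w t₁ < 0 ∧
      ∀ t ∈ Set.Icc t₀ t₁, |x t| ≤ η ∧ |w t| ≤ η ∧
        r ^ 6 / 2 ≤ energy a (x t) (w t) ∧ energy a (x t) (w t) ≤ 2 * r ^ 6 := by
  obtain ⟨t₁, h1, h2, h3, h4, h5⟩ := h.neg.exists_right_arc hη.neg_left.neg_mid hr hrη
    (t₀ := t₀) (by rwa [abs_neg]) (by rwa [energy_neg_neg])
    (by simpa only [neg_pos, neg_lt_zero, neg_eq_zero] using h₀)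
  refine ⟨t₁, h1, fun t ht => neg_pos.1 (h2 t ht), neg_eq_zero.1 h3, neg_pos.1 h4,
    fun t ht => ?_⟩
  have := h5 t ht
  rwa [abs_neg, abs_neg, energy_neg_neg] at this

/-- A strictly increasing continuous function on a segment has a continuous right inverse. -/
theorem exists_continuousOn_rightInverse {f : ℝ → ℝ} {p q : ℝ} (hpq : p ≤ q)
    (hc : ContinuousOn f (Set.Icc p q)) (hm : StrictMonoOn f (Set.Icc p q)) :
    ∃ v : ℝ → ℝ, ContinuousOn v (Set.Icc (f p) (f q)) ∧
      ∀ y ∈ Set.Icc (f p) (f q), v y ∈ Set.Icc p q ∧ f (v y) = y := by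
  have hex : ∀ y, ∃ t, y ∈ Set.Icc (f p) (f q) → t ∈ Set.Icc p q ∧ f t = y := by
    intro y
    by_cases hy : y ∈ Set.Icc (f p) (f q)
    · obtain ⟨t, ht, hty⟩ := intermediate_value_Icc hpq hc hy
      exact ⟨t, fun _ => ⟨ht, hty⟩⟩
    · exact ⟨0, fun h => absurd h hy⟩
  choose v hv using hex
  refine ⟨v, fun y hy => tendsto_order.2 ⟨fun l hl => ?_, fun u hu => ?_⟩, hv⟩
  · rcases lt_or_ge l p with h1 | h1
    · filter_upwards [self_mem_nhdsWithin] with z hz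
      exact h1.trans_le (hv z hz).1.1
    · have hlm : l ∈ Set.Icc p q := ⟨h1, hl.le.trans (hv y hy).1.2⟩
      have hfl : f l < y := by
        have := hm hlm (hv y hy).1 hl
        rwa [(hv y hy).2] at this
      filter_upwards [self_mem_nhdsWithin, nhdsWithin_le_nhds (lt_mem_nhds hfl)] with z hz hlz
      refine (hm.lt_iff_lt hlm (hv z hz).1).1 ?_
      rwa [(hv z hz).2]
  · rcases lt_or_ge q u with h1 | h1
    · filter_upwards [self_mem_nhdsWithin] with z hz
      exact (hv z hz).1.2.trans_lt h1
    · have hum : u ∈ Set.Icc p q := ⟨(hv y hy).1.1.trans hu.le, h1⟩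
      have hfu : y < f u := by
        have := hm (hv y hy).1 hum hu
        rwa [(hv y hy).2] at this
      filter_upwards [self_mem_nhdsWithin, nhdsWithin_le_nhds (gt_mem_nhds hfu)] with z hz hlz
      refine (hm.lt_iff_lt (hv z hz).1 hum).1 ?_
      rwa [(hv z hz).2]

theorem IsSmall.force_pos {a b c η : ℝ} (h : IsSmall a b c η) {x : ℝ} (hx : |x| ≤ η)
    (h0 : 0 < x) : 0 < force a x :=
  lt_of_lt_of_le (by positivity) (h.force_ge hx h0.le)

/-- Comparison of the right and left arcs of one turn of a solution. -/
theorem IsLienardOn.comparison {a b c η : ℝ} {x w : ℝ → ℝ} (h : IsLienardOn a b c η x w)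
    (hη : IsSmall a b c η) {K t₀ t₁ t₂ : ℝ} (h01 : t₀ < t₁) (h12 : t₁ < t₂)
    (hbox : ∀ t ∈ Set.Icc t₀ t₂, |x t| ≤ η ∧ |w t| ≤ η)
    (hR : ∀ t ∈ Set.Ioo t₀ t₁, 0 < x t) (hL : ∀ t ∈ Set.Ioo t₁ t₂, x t < 0)
    (hx0 : x t₀ = 0) (hw20 : w t₂ ≤ w t₀)
    (hK : ∀ X Y, 0 < X → X ≤ η → -η ≤ Y → Y < 0 →
      force a X * (damping b c X - damping b c Y) ≤ K * |potential a X - potential a Y|) :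
    w t₂ = w t₀ ∧ ∃ X Y, 0 < X ∧ X ≤ η ∧ -η ≤ Y ∧ Y < 0 ∧ potential a X = potential a Y ∧
      damping b c X = damping b c Y := by
  have bR : ∀ t ∈ Set.Icc t₀ t₁, |x t| ≤ η ∧ |w t| ≤ η := fun t ht =>
    hbox t ⟨ht.1, ht.2.trans h12.le⟩
  have bL : ∀ t ∈ Set.Icc t₁ t₂, |x t| ≤ η ∧ |w t| ≤ η := fun t ht =>
    hbox t ⟨h01.le.trans ht.1, ht.2⟩
  have mR : StrictMonoOn w (Set.Icc t₀ t₁) :=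
    strictMonoOn_of_deriv_pos (convex_Icc _ _) h.contW.continuousOn fun t ht => by
      rw [interior_Icc] at ht
      obtain ⟨u1, u2⟩ := bR t (Set.Ioo_subset_Icc_self ht)
      rw [(h.derivW t u1 u2).deriv]
      exact hη.force_pos u1 (hR t ht)
  have mL : StrictMonoOn (fun t => -w t) (Set.Icc t₁ t₂) :=
    strictMonoOn_of_deriv_pos (convex_Icc _ _) h.contW.neg.continuousOn fun t ht => by
      rw [interior_Icc] at ht
      obtain ⟨u1, u2⟩ := bL t (Set.Ioo_subset_Icc_self ht)
      have hd : HasDerivAt (fun t => -w t) (-force a (x t)) t := (h.derivW t u1 u2).neg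
      rw [hd.deriv]
      exact neg_pos.2 (hη.force_neg u1 (hL t ht))
  obtain ⟨v, cv, hv⟩ := exists_continuousOn_rightInverse h12.le h.contW.neg.continuousOn mL
  have hmaps : ∀ t ∈ Set.Icc t₀ t₁, -w t ∈ Set.Icc (-w t₁) (-w t₂) := fun t ht =>
    ⟨neg_le_neg (mR.monotoneOn ht (Set.right_mem_Icc.2 h01.le) ht.2),
      neg_le_neg (hw20.trans (mR.monotoneOn (Set.left_mem_Icc.2 h01.le) ht ht.1))⟩
  set τ : ℝ → ℝ := fun t => v (-w t) with hτ
  have τmem : ∀ t ∈ Set.Icc t₀ t₁, τ t ∈ Set.Icc t₁ t₂ := fun t ht => (hv _ (hmaps t ht)).1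
  have τw : ∀ t ∈ Set.Icc t₀ t₁, w (τ t) = w t := fun t ht =>
    neg_injective (hv _ (hmaps t ht)).2
  have hmaps' : ∀ t ∈ Set.Ioo t₀ t₁, -w t ∈ Set.Ioo (-w t₁) (-w t₂) := fun t ht =>
    ⟨neg_lt_neg (mR (Set.Ioo_subset_Icc_self ht) (Set.right_mem_Icc.2 h01.le) ht.2),
      neg_lt_neg (hw20.trans_lt
        (mR (Set.left_mem_Icc.2 h01.le) (Set.Ioo_subset_Icc_self ht) ht.1))⟩
  have τmem' : ∀ t ∈ Set.Ioo t₀ t₁, τ t ∈ Set.Ioo t₁ t₂ := by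
    intro t ht
    have h1 := τmem t (Set.Ioo_subset_Icc_self ht)
    have h2 := τw t (Set.Ioo_subset_Icc_self ht)
    have h3 := hmaps' t ht
    refine ⟨lt_of_le_of_ne h1.1 fun he => ?_, lt_of_le_of_ne h1.2 fun he => ?_⟩
    · rw [← he] at h2
      linarith [h3.1]
    · rw [he] at h2
      linarith [h3.2]
  have cτ : ContinuousOn τ (Set.Icc t₀ t₁) :=
    cv.comp h.contW.neg.continuousOn hmaps
  set δ : ℝ → ℝ := fun t => energy a (x t) (w t) - energy a (x (τ t)) (w (τ t)) with hδ
  have δeq : ∀ t ∈ Set.Icc t₀ t₁, δ t = potential a (x t) - potential a (x (τ t)) := by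
    intro t ht
    simp only [hδ, energy, τw t ht]
    ring
  have dδ : ∀ t ∈ Set.Ioo t₀ t₁, HasDerivAt δ
      (force a (x t) * (damping b c (x t) - damping b c (x (τ t)))) t := by
    intro t ht
    obtain ⟨u1, u2⟩ := bR t (Set.Ioo_subset_Icc_self ht)
    obtain ⟨v1, v2⟩ := bL (τ t) (Set.Ioo_subset_Icc_self (τmem' t ht))
    have hne := (hη.force_neg v1 (hL _ (τmem' t ht))).ne
    have dv : HasDerivAt v (-force a (x (τ t)))⁻¹ (-w t) := by
      refine HasDerivAt.of_local_left_inverse (f := fun t => -w t)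
        (cv.continuousAt (Icc_mem_nhds (hmaps' t ht).1 (hmaps' t ht).2))
        (h.derivW (τ t) v1 v2).neg (neg_ne_zero.2 hne) ?_
      filter_upwards [Icc_mem_nhds (hmaps' t ht).1 (hmaps' t ht).2] with y hy
      exact (hv y hy).2
    have dτ : HasDerivAt τ ((-force a (x (τ t)))⁻¹ * -force a (x t)) t :=
      dv.comp t (h.derivW t u1 u2).neg
    have := (h.hasDerivAt_energy u1 u2).sub ((h.hasDerivAt_energy v1 v2).comp t dτ)
    refine this.congr_deriv ?_
    field_simp
  have cδ : ContinuousOn δ (Set.Icc t₀ t₁) :=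
    h.continuous_energy.continuousOn.sub (h.continuous_energy.comp_continuousOn cτ)
  have memt : ∀ t ∈ Set.Ioo t₀ t₁,
      0 < x t ∧ x t ≤ η ∧ -η ≤ x (τ t) ∧ x (τ t) < 0 := by
    intro t ht
    obtain ⟨u1, _⟩ := bR t (Set.Ioo_subset_Icc_self ht)
    obtain ⟨v1, _⟩ := bL (τ t) (Set.Ioo_subset_Icc_self (τmem' t ht))
    exact ⟨hR t ht, (abs_le.1 u1).2, (abs_le.1 v1).1, hL _ (τmem' t ht)⟩
  have m0 : t₀ ∈ Set.Icc t₀ t₁ := Set.left_mem_Icc.2 h01.le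
  have m1 : t₁ ∈ Set.Icc t₀ t₁ := Set.right_mem_Icc.2 h01.le
  have τ1 : τ t₁ = t₁ :=
    mL.injOn (τmem t₁ m1) (Set.left_mem_Icc.2 h12.le) (congrArg Neg.neg (τw t₁ m1))
  have zero := eq_zero_of_deriv_le_mul_abs (K := K) cδ dδ
    (fun t ht => by
      obtain ⟨k1, k2, k3, k4⟩ := memt t ht
      rw [δeq t (Set.Ioo_subset_Icc_self ht)]
      exact hK _ _ k1 k2 k3 k4)
    (by
      rw [δeq t₀ m0, hx0, potential_zero]
      have := hη.potential_ge (bL _ (τmem t₀ m0)).1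
      have h6 : 0 ≤ x (τ t₀) ^ 6 := by positivity
      linarith)
    (by rw [δeq t₁ m1, τ1, sub_self])
  constructor
  · have z0 := zero t₀ m0
    rw [δeq t₀ m0, hx0, potential_zero] at z0
    have hge := hη.potential_ge (bL _ (τmem t₀ m0)).1
    have hxτ : x (τ t₀) = 0 := by
      have h6 : 0 ≤ x (τ t₀) ^ 6 := by positivity
      exact pow_eq_zero_iff (by norm_num : 6 ≠ 0) |>.1 (by linarith)
    rw [← τw t₀ m0]
    rcases (τmem t₀ m0).2.eq_or_lt with he | hlt
    · rw [he]
    · rcases (τmem t₀ m0).1.eq_or_lt with he | hlt'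
      · have h1 := τw t₀ m0
        rw [← he] at h1
        exact absurd (mR m0 m1 h01) (by rw [h1]; exact lt_irrefl _)
      · exact absurd hxτ (hL _ ⟨hlt', hlt⟩).ne
  · have hmid : (t₀ + t₁) / 2 ∈ Set.Ioo t₀ t₁ := ⟨by linarith, by linarith⟩
    set s := (t₀ + t₁) / 2 with hs
    obtain ⟨k1, k2, k3, k4⟩ := memt s hmid
    have z := zero s (Set.Ioo_subset_Icc_self hmid)
    rw [δeq s (Set.Ioo_subset_Icc_self hmid)] at z
    refine ⟨x s, x (τ s), k1, k2, k3, k4, by linarith, ?_⟩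
    have hd : force a (x s) * (damping b c (x s) - damping b c (x (τ s))) = 0 := by
      refine (dδ s hmid).unique ?_
      refine (hasDerivAt_const s (0 : ℝ)).congr_of_eventuallyEq ?_
      filter_upwards [Icc_mem_nhds hmid.1 hmid.2] with t ht
      exact zero t ht
    have hf := hη.force_pos (bR s (Set.Ioo_subset_Icc_self hmid)).1 k1
    rcases mul_eq_zero.1 hd with h1 | h1
    · exact absurd h1 hf.ne'
    · linarith

/-- One turn of a small solution starting on the negative vertical axis. -/
theorem IsLienardOn.exists_turn {a b c η : ℝ} {x w : ℝ → ℝ}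
    (h : IsLienardOn a b c η x w) (hη : IsSmall a b c η) {r t₀ : ℝ} (hr : 0 < r)
    (hrη : r ≤ η / 8) (hx₀ : x t₀ = 0) (hw₀ : w t₀ < 0)
    (hE : energy a (x t₀) (w t₀) = r ^ 6) :
    ∃ t₁ t₂, t₀ < t₁ ∧ t₁ < t₂ ∧ (∀ t ∈ Set.Ioo t₀ t₁, 0 < x t) ∧
      (∀ t ∈ Set.Ioo t₁ t₂, x t < 0) ∧ x t₁ = 0 ∧ x t₂ = 0 ∧ w t₂ < 0 ∧
      ∀ t ∈ Set.Icc t₀ t₂, |x t| ≤ η ∧ |w t| ≤ η ∧ 0 < energy a (x t) (w t) := by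
  have hr6 : 0 < r ^ 6 := by positivity
  obtain ⟨t₁, h01, hR, hx1, hw1, hb1⟩ := h.exists_right_arc hη hr (by linarith [hη.pos])
    (by rw [hx₀, abs_zero]; exact hη.pos.le) hE (Or.inr ⟨hx₀, hw₀⟩)
  obtain ⟨k1, k2, k3, k4⟩ := hb1 t₁ (Set.right_mem_Icc.2 h01.le)
  obtain ⟨s, hs0, hs⟩ : ∃ s : ℝ, 0 < s ∧ s ^ 6 = energy a (x t₁) (w t₁) :=
    ⟨_, Real.rpow_pos_of_pos (by linarith) (1 / 6), by
      rw [← Real.rpow_natCast, ← Real.rpow_mul (by linarith)]; norm_num⟩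
  have hsr : s ≤ 2 * r := by
    refine (pow_le_pow_iff_left₀ hs0.le (by positivity) (by norm_num : 6 ≠ 0)).1 ?_
    rw [mul_pow, hs]
    linarith
  have hs6 : 0 < s ^ 6 := by positivity
  obtain ⟨t₂, h12, hL, hx2, hw2, hb2⟩ := h.exists_left_arc hη hs0 (by linarith) k1 hs.symm
    (Or.inr ⟨hx1, hw1⟩)
  refine ⟨t₁, t₂, h01, h12, hR, hL, hx1, hx2, hw2, fun t ht => ?_⟩
  rcases le_total t t₁ with h1 | h1
  · obtain ⟨e1, e2, e3, _⟩ := hb1 t ⟨ht.1, h1⟩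
    exact ⟨e1, e2, by linarith⟩
  · obtain ⟨e1, e2, e3, _⟩ := hb2 t ⟨h1, ht.2⟩
    exact ⟨e1, e2, by linarith⟩

/-- The strict one-sided comparison between the damping on the right and on the left. -/
def IsOneSided (a b c η K : ℝ) : Prop :=
  ∀ X Y, 0 < X → X ≤ η → -η ≤ Y → Y < 0 →
    force a X * (damping b c X - damping b c Y) < K * |potential a X - potential a Y|

theorem IsLienardOn.not_periodic {a b c η : ℝ} {x w : ℝ → ℝ} (h : IsLienardOn a b c η x w)
    (hη : IsSmall a b c η) {K T : ℝ} (hK : IsOneSided a b c η K) (hT : 0 < T)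
    (hx : Function.Periodic x T) (hw : Function.Periodic w T) (hne : ∀ t, x t = 0 → w t ≠ 0)
    (hx0 : x 0 = 0) (hw0 : w 0 ≤ 0) (hsmall : w 0 ^ 2 / 2 ≤ (η / 8) ^ 6) : False := by
  let S : Set ℝ := Set.Icc 0 T ∩ ({t | x t = 0} ∩ {t | w t ≤ 0})
  have hS : IsCompact S := isCompact_Icc.inter_right
    ((isClosed_eq h.contX continuous_const).inter (isClosed_le h.contW continuous_const))
  have h0S : (0 : ℝ) ∈ S := ⟨⟨le_rfl, hT.le⟩, hx0, hw0⟩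
  obtain ⟨t₀, ht₀, hmax⟩ := hS.exists_isMaxOn ⟨0, h0S⟩ h.contW.continuousOn
  have hw₀ : w t₀ < 0 := lt_of_le_of_ne ht₀.2.2 (hne t₀ ht₀.2.1)
  have hpos : 0 < w t₀ ^ 2 / 2 := by nlinarith
  obtain ⟨r, hr0, hr⟩ : ∃ s : ℝ, 0 < s ∧ s ^ 6 = w t₀ ^ 2 / 2 :=
    ⟨_, Real.rpow_pos_of_pos hpos (1 / 6), by
      rw [← Real.rpow_natCast, ← Real.rpow_mul hpos.le]; norm_num⟩
  have hle : w 0 ≤ w t₀ := hmax h0S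
  have hrη : r ≤ η / 8 := by
    refine (pow_le_pow_iff_left₀ hr0.le (by linarith [hη.pos]) (by norm_num : 6 ≠ 0)).1 ?_
    rw [hr]
    nlinarith
  obtain ⟨t₁, t₂, h01, h12, hR, hL, _, hx2, hw2, hb⟩ :=
    h.exists_turn hη hr0 hrη ht₀.2.1 hw₀ (by rw [ht₀.2.1, energy_zero_left, hr])
  have hw20 : w t₂ ≤ w t₀ := by
    have hper : Function.Periodic (fun t => (x t, w t)) T := fun t => by
      simp only [hx t, hw t]
    obtain ⟨s, hs, hse⟩ := hper.exists_mem_Ico₀ hT t₂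
    obtain ⟨e1, e2⟩ := Prod.mk.inj hse
    rw [e2]
    exact hmax ⟨⟨hs.1, hs.2.le⟩, e1.symm.trans hx2, (e2.symm.trans_lt hw2).le⟩
  obtain ⟨_, X, Y, k1, k2, k3, k4, k5, k6⟩ := h.comparison hη (K := K) h01 h12
    (fun t ht => ⟨(hb t ht).1, (hb t ht).2.1⟩) hR hL ht₀.2.1 hw20
    (fun X Y h1 h2 h3 h4 => (hK X Y h1 h2 h3 h4).le)
  have := hK X Y k1 k2 k3 k4
  rw [k5, k6] at this
  simp at this

theorem IsSolution.isLienardOn {a b c : ℝ} {γ : ℝ → ℝ × ℝ}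
    (h : IsSolution (quinticSystem a b c) γ) (η : ℝ) :
    IsLienardOn a b c η (fun t => (γ t).1) (fun t => (γ t).2 + damping b c (γ t).1) := by
  have hc : Continuous γ := continuous_iff_continuousAt.2 fun t => (h t).continuousAt
  have d1 : ∀ t, HasDerivAt (fun t => (γ t).1) (-(γ t).2) t := fun t => (h t).fst
  have d2 : ∀ t, HasDerivAt (fun t => (γ t).2) ((γ t).1 ^ 5 + a * (γ t).1 ^ 6 +
      (γ t).2 * (b * (γ t).1 ^ 3 + c * (γ t).1 ^ 4)) t := fun t => (h t).snd
  refine ⟨hc.fst, ?_, fun t _ _ => ?_, fun t _ _ => ?_⟩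
  · unfold damping
    fun_prop
  · exact (d1 t).congr_deriv (by ring)
  · refine ((d2 t).add ((hasDerivAt_damping b c _).comp t (d1 t))).congr_deriv ?_
    unfold force
    ring

theorem not_isCenter_of_isOneSided {a b c η K : ℝ} (hη : IsSmall a b c η)
    (hK : IsOneSided a b c η K ∨ IsOneSided (-a) b (-c) η K) :
    ¬ IsCenter (quinticSystem a b c) (0, 0) := by
  rintro ⟨-, U, hU, hcen⟩
  obtain ⟨ρ, hρ, hρU, hρη⟩ : ∃ ρ : ℝ, 0 < ρ ∧ ((0, -ρ) : ℝ × ℝ) ∈ U ∧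
      (-ρ) ^ 2 / 2 ≤ (η / 8) ^ 6 := by
    have hη0 := hη.pos
    have c1 : Tendsto (fun ρ : ℝ => ((0, -ρ) : ℝ × ℝ)) (𝓝[>] 0) (𝓝 (0, 0)) := by
      have : Continuous fun ρ : ℝ => ((0, -ρ) : ℝ × ℝ) := by fun_prop
      simpa using (this.tendsto 0).mono_left nhdsWithin_le_nhds
    have c2 : Tendsto (fun ρ : ℝ => (-ρ) ^ 2 / 2) (𝓝[>] 0) (𝓝 0) := by
      have : Continuous fun ρ : ℝ => (-ρ) ^ 2 / 2 := by fun_prop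
      simpa using (this.tendsto 0).mono_left nhdsWithin_le_nhds
    have hp : 0 < (η / 8) ^ 6 := by positivity
    obtain ⟨ρ, h1, h2, h3⟩ := ((c1.eventually hU).and
      ((c2.eventually (gt_mem_nhds hp)).and self_mem_nhdsWithin)).exists
    exact ⟨ρ, h3, h1, h2.le⟩
  obtain ⟨γ, hγ0, ⟨hsol, _, T, hT, hper⟩, hmem⟩ := hcen (0, -ρ)
    ⟨hρU, fun h => by simpa [hρ.ne'] using congrArg Prod.snd (Set.mem_singleton_iff.1 h)⟩
  have hL := hsol.isLienardOn η
  have hx : Function.Periodic (fun t => (γ t).1) T := fun t => by simp only [hper t]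
  have hw : Function.Periodic (fun t => (γ t).2 + damping b c (γ t).1) T := fun t => by
    simp only [hper t]
  have hne : ∀ t, (γ t).1 = 0 → (γ t).2 + damping b c (γ t).1 ≠ 0 := by
    intro t h1 h2
    rw [h1, damping_zero, add_zero] at h2
    exact (hmem t).2 (Prod.ext h1 h2)
  have hw0 : (γ 0).2 + damping b c (γ 0).1 = -ρ := by
    rw [hγ0, damping_zero, add_zero]
  rcases hK with hK | hK
  · exact hL.not_periodic hη hK hT hx hw hne (by rw [hγ0]) (by rw [hw0]; linarith)
      (by rw [hw0]; exact hρη)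
  · refine hL.reflect.not_periodic hη.neg_left.neg_right hK hT
      (fun t => ?_) (fun t => ?_) (fun t ht => hne (-t) (neg_eq_zero.1 ht)) ?_ ?_ ?_
    · simp only [neg_add, ← sub_eq_add_neg, hper.sub_eq]
    · simp only [neg_add, ← sub_eq_add_neg, hper.sub_eq]
    · simp [hγ0]
    · rw [neg_zero, hw0]; linarith
    · rw [neg_zero, hw0]; exact hρη

/-- The cube root of `1 + 6 a x / 7`. -/
noncomputable def cubeFactor (a x : ℝ) : ℝ := (1 + 6 / 7 * a * x) ^ (1 / 3 : ℝ)

/-- The part of the damping that is not a combination of `(6 G)^(2/3)` and `6 G`, where `G` is the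
potential. -/
noncomputable def oddPart (a b c q x : ℝ) : ℝ :=
  damping b c x - b / 4 * (x ^ 2 * cubeFactor a x) ^ 2 - 6 * q * potential a x

theorem cubeFactor_neg_neg (a x : ℝ) : cubeFactor (-a) (-x) = cubeFactor a x := by
  unfold cubeFactor
  congr 1
  ring

theorem oddPart_neg_neg (a b c q x : ℝ) :
    oddPart (-a) b (-c) q (-x) = oddPart a b c q x := by
  simp only [oddPart, damping_neg_right, cubeFactor_neg_neg, potential_neg_neg, neg_sq]

theorem cubeFactor_pos {a x : ℝ} (h : |a * x| ≤ 1 / 2) : 0 < cubeFactor a x := by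
  have := abs_le.1 h
  exact Real.rpow_pos_of_pos (by linarith) _

theorem cubeFactor_pow {a x : ℝ} (h : |a * x| ≤ 1 / 2) :
    cubeFactor a x ^ 3 = 1 + 6 / 7 * a * x := by
  have := abs_le.1 h
  unfold cubeFactor
  rw [← Real.rpow_natCast, ← Real.rpow_mul (by linarith)]
  norm_num

theorem tendsto_cubeFactor (a : ℝ) : Tendsto (cubeFactor a) (𝓝 0) (𝓝 1) := by
  have : ContinuousAt (cubeFactor a) 0 := by
    unfold cubeFactor
    exact ContinuousAt.rpow_const (by fun_prop) (Or.inl (by norm_num))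
  simpa [cubeFactor] using this.tendsto

theorem eventually_abs_mul_le (a : ℝ) : ∀ᶠ x in 𝓝 (0 : ℝ), |a * x| ≤ 1 / 2 := by
  have hc : Continuous fun x : ℝ => |a * x| := by fun_prop
  have h0 : Tendsto (fun x : ℝ => |a * x|) (𝓝 0) (𝓝 0) := by simpa using hc.tendsto 0
  filter_upwards [h0.eventually (gt_mem_nhds (by norm_num : (0 : ℝ) < 1 / 2))] with x hx
  exact hx.le

/-- Unless `a b = 0` and `c = 0`, the odd part of the damping has a constant sign on each side. -/
theorem exists_oddPart_sign {a b c : ℝ} (h : ¬ (a * b = 0 ∧ c = 0)) :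
    ∃ q, (∀ᶠ x in 𝓝 (0 : ℝ), x ≠ 0 → x * oddPart a b c q x < 0) ∨
      (∀ᶠ x in 𝓝 (0 : ℝ), x ≠ 0 → 0 < x * oddPart a b c q x) := by
  by_cases hd : c / 5 - b * a / 7 = 0
  · have hab : a * b ≠ 0 := fun h0 => h ⟨h0, by rw [mul_comm b a, h0] at hd; linarith⟩
    have hc : c = 5 * (b * a / 7) := by linarith
    have key : ∀ x, |a * x| ≤ 1 / 2 → x ≠ 0 → ∃ P, 0 < P ∧
        x * oddPart a b c (b * a ^ 2 / 49) x = -(a * b) * P := by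
      intro x hx hx0
      have hm := cubeFactor_pos hx
      have hm3 := cubeFactor_pow hx
      set m := cubeFactor a x with hmdef
      have ha : a ≠ 0 := left_ne_zero_of_mul hab
      have hm1 : m - 1 ≠ 0 := by
        intro h1
        have : m = 1 := by linarith
        rw [this] at hm3
        have : a * x = 0 := by linarith
        exact (mul_ne_zero ha hx0) this
      have h4 : 0 < (m - 1) ^ 4 := by positivity
      refine ⟨7 / 216 / a ^ 2 * x ^ 4 * (m - 1) ^ 4 * (1 + m + m ^ 2) *
        (m ^ 6 + 3 * m ^ 5 + 6 * m ^ 4 + 8 * m ^ 3 + 9 * m ^ 2 + 9 * m + 3),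
        by positivity, ?_⟩
      have hxm : x = 7 * (m ^ 3 - 1) / (6 * a) := by
        field_simp
        linarith
      have hpot : potential a x = x ^ 6 * m ^ 3 / 6 := by
        rw [hm3]; unfold potential; ring
      unfold oddPart damping
      rw [← hmdef, hpot, hc]
      generalize m = m at *
      subst hxm
      field_simp
      ring
    refine ⟨b * a ^ 2 / 49, ?_⟩
    rcases lt_or_gt_of_ne hab with h1 | h1
    · right
      filter_upwards [eventually_abs_mul_le a] with x hx hx0
      obtain ⟨P, hP, he⟩ := key x hx hx0
      rw [he]
      exact mul_pos (neg_pos.2 h1) hP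
    · left
      filter_upwards [eventually_abs_mul_le a] with x hx hx0
      obtain ⟨P, hP, he⟩ := key x hx hx0
      rw [he]
      exact mul_neg_of_neg_of_pos (neg_neg_of_pos h1) hP
  · set κ : ℝ → ℝ := fun x => c / 5 - 3 / 14 * (b * a) * (1 + cubeFactor a x) /
      (1 + cubeFactor a x + cubeFactor a x ^ 2) with hκ
    have tκ : Tendsto κ (𝓝 0) (𝓝 (c / 5 - b * a / 7)) := by
      have hm := tendsto_cubeFactor a
      have h1 : Tendsto κ (𝓝 0) (𝓝 (c / 5 - 3 / 14 * (b * a) * (1 + 1) / (1 + 1 + 1 ^ 2))) :=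
        tendsto_const_nhds.sub (((tendsto_const_nhds.add hm).const_mul _).div
          ((tendsto_const_nhds.add hm).add (hm.pow 2)) (by norm_num))
      convert h1 using 2
      ring
    have key : ∀ x, |a * x| ≤ 1 / 2 → x * oddPart a b c 0 x = x ^ 6 * κ x := by
      intro x hx
      have hm := cubeFactor_pos hx
      have hm3 := cubeFactor_pow hx
      simp only [hκ, oddPart, damping]
      set m := cubeFactor a x with hmdef
      have hden : 1 + m + m ^ 2 ≠ 0 := by positivity
      have h2 : 1 - m ^ 2 = -(6 / 7 * a * x * (1 + m) / (1 + m + m ^ 2)) := by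
        rw [eq_comm, neg_eq_iff_eq_neg, div_eq_iff hden]
        linear_combination (-(1 + m)) * hm3
      linear_combination (b / 4 * x ^ 5) * h2
    have h6 : ∀ x : ℝ, x ≠ 0 → 0 < x ^ 6 := fun x hx => by positivity
    refine ⟨0, ?_⟩
    rcases lt_or_gt_of_ne hd with h1 | h1
    · left
      filter_upwards [eventually_abs_mul_le a, tκ.eventually (gt_mem_nhds h1)] with x hx h2 hx0
      rw [key x hx]
      exact mul_neg_of_pos_of_neg (h6 x hx0) h2
    · right
      filter_upwards [eventually_abs_mul_le a, tκ.eventually (lt_mem_nhds h1)] with x hx h2 hx0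
      rw [key x hx]
      exact mul_pos (h6 x hx0) h2

theorem IsSmall.isOneSided_of_oddPart {a b c η q : ℝ} (hη : IsSmall a b c η)
    (h : ∀ x, |x| ≤ η → x ≠ 0 → x * oddPart a b c q x < 0) :
    IsOneSided a b c η (6 * |b| + 12 * |q|) := by
  intro X Y hX hXη hYη hY
  have aX : |X| ≤ η := by rwa [abs_of_pos hX]
  have aY : |Y| ≤ η := abs_le.2 ⟨hYη, by linarith [hη.pos]⟩
  have X1 : X ≤ 1 := hXη.trans hη.le_one
  have eX : oddPart a b c q X < 0 := by nlinarith [h X aX hX.ne']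
  have eY : 0 < oddPart a b c q Y := by nlinarith [h Y aY hY.ne]
  have mX := cubeFactor_pos (hη.abs_mul_le aX)
  have mY := cubeFactor_pos (hη.abs_mul_le aY)
  have mX3 := cubeFactor_pow (hη.abs_mul_le aX)
  have mY3 := cubeFactor_pow (hη.abs_mul_le aY)
  have gpos := hη.force_pos aX hX
  have gle := hη.force_le aX hX.le
  set sX := X ^ 2 * cubeFactor a X with hsX
  set sY := Y ^ 2 * cubeFactor a Y with hsY
  have sX0 : 0 < sX := by positivity
  have sY0 : 0 < sY := mul_pos (sq_pos_of_neg hY) mY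
  have sX3 : sX ^ 3 = 6 * potential a X := by
    rw [hsX, mul_pow, mX3]; unfold potential; ring
  have sY3 : sY ^ 3 = 6 * potential a Y := by
    rw [hsY, mul_pow, mY3]; unfold potential; ring
  set Δ := potential a X - potential a Y with hΔ
  have hcube : |sX - sY| * (sX ^ 2 + sX * sY + sY ^ 2) = 6 * |Δ| := by
    rw [← abs_of_pos (by positivity : 0 < sX ^ 2 + sX * sY + sY ^ 2), ← abs_mul,
      ← abs_of_pos (by norm_num : (0 : ℝ) < 6), ← abs_mul]
    congr 1
    rw [hΔ]
    linear_combination sX3 - sY3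
  have hmX : 1 / 2 ≤ cubeFactor a X := by
    refine (pow_le_pow_iff_left₀ (by norm_num) mX.le (by norm_num : 3 ≠ 0)).1 ?_
    rw [mX3]
    have := abs_le.1 (hη.abs_mul_le aX)
    norm_num
    linarith
  have g4 : force a X ≤ 4 * sX := by
    have h5 : X ^ 5 ≤ X ^ 2 := pow_le_pow_of_le_one hX.le X1 (by norm_num)
    have : X ^ 2 * (1 / 2) ≤ sX := mul_le_mul_of_nonneg_left hmX (by positivity)
    linarith
  have g2 : force a X ≤ 2 := by
    have h5 : X ^ 5 ≤ 1 := pow_le_one₀ hX.le X1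
    linarith
  have hsq : force a X * |sX ^ 2 - sY ^ 2| ≤ 24 * |Δ| := by
    have e1 : |sX ^ 2 - sY ^ 2| = |sX - sY| * (sX + sY) := by
      rw [← abs_of_pos (by positivity : 0 < sX + sY), ← abs_mul]
      congr 1
      ring
    calc force a X * |sX ^ 2 - sY ^ 2| ≤ 4 * sX * |sX ^ 2 - sY ^ 2| :=
          mul_le_mul_of_nonneg_right g4 (abs_nonneg _)
      _ = 4 * (|sX - sY| * (sX * (sX + sY))) := by rw [e1]; ring
      _ ≤ 4 * (|sX - sY| * (sX ^ 2 + sX * sY + sY ^ 2)) := by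
          refine mul_le_mul_of_nonneg_left (mul_le_mul_of_nonneg_left ?_ (abs_nonneg _))
            (by norm_num)
          nlinarith
      _ = 24 * |Δ| := by rw [hcube]; ring
  have hdiff : damping b c X - damping b c Y = b / 4 * (sX ^ 2 - sY ^ 2) + 6 * q * Δ +
      (oddPart a b c q X - oddPart a b c q Y) := by
    simp only [oddPart, hsX, hsY, hΔ]
    ring
  have p1 : force a X * (b / 4 * (sX ^ 2 - sY ^ 2)) ≤ 6 * |b| * |Δ| := by
    calc force a X * (b / 4 * (sX ^ 2 - sY ^ 2))
        ≤ |force a X * (b / 4 * (sX ^ 2 - sY ^ 2))| := le_abs_self _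
      _ = |b| / 4 * (force a X * |sX ^ 2 - sY ^ 2|) := by
          rw [abs_mul, abs_mul, abs_of_pos gpos, abs_div,
            abs_of_pos (by norm_num : (0 : ℝ) < 4)]
          ring
      _ ≤ |b| / 4 * (24 * |Δ|) := mul_le_mul_of_nonneg_left hsq (by positivity)
      _ = 6 * |b| * |Δ| := by ring
  have p2 : force a X * (6 * q * Δ) ≤ 12 * |q| * |Δ| := by
    calc force a X * (6 * q * Δ) ≤ |force a X * (6 * q * Δ)| := le_abs_self _
      _ = force a X * (6 * |q| * |Δ|) := by
          rw [abs_mul, abs_mul, abs_mul, abs_of_pos gpos,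
            abs_of_pos (by norm_num : (0 : ℝ) < 6)]
      _ ≤ 2 * (6 * |q| * |Δ|) := mul_le_mul_of_nonneg_right g2 (by positivity)
      _ = 12 * |q| * |Δ| := by ring
  have p3 : force a X * (oddPart a b c q X - oddPart a b c q Y) < 0 :=
    mul_neg_of_pos_of_neg gpos (by linarith)
  rw [hdiff, mul_add, mul_add, add_mul]
  linarith

theorem exists_isSmall (a b c : ℝ) {d : ℝ} (hd : 0 < d) : ∃ η, IsSmall a b c η ∧ η < d := by
  have t1 : Tendsto (fun η : ℝ => |a| * η) (𝓝[>] 0) (𝓝 0) := by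
    have : Continuous fun η : ℝ => |a| * η := by fun_prop
    simpa using (this.tendsto 0).mono_left nhdsWithin_le_nhds
  have t2 : Tendsto (fun η : ℝ => 192 * (|b| + |c|) * η) (𝓝[>] 0) (𝓝 0) := by
    have : Continuous fun η : ℝ => 192 * (|b| + |c|) * η := by fun_prop
    simpa using (this.tendsto 0).mono_left nhdsWithin_le_nhds
  obtain ⟨η, h1, h2, h3, h4⟩ :=
    ((t1.eventually (gt_mem_nhds (by norm_num : (0 : ℝ) < 1 / 2))).and
    ((t2.eventually (gt_mem_nhds (by norm_num : (0 : ℝ) < 1))).and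
    ((show ∀ᶠ η in 𝓝[>] (0 : ℝ), η ∈ Set.Ioo 0 d from Ioo_mem_nhdsGT hd).and
    (Ioo_mem_nhdsGT one_pos)))).exists
  exact ⟨η, ⟨h3.1, h4.2.le, h1.le, h2.le⟩, h3.2⟩

theorem eq_zero_of_isCenter {a b c : ℝ} (hcen : IsCenter (quinticSystem a b c) (0, 0)) :
    a * b = 0 ∧ c = 0 := by
  by_contra hne
  obtain ⟨q, h | h⟩ := exists_oddPart_sign hne
  · obtain ⟨d, hd, hball⟩ := Metric.eventually_nhds_iff.1 h
    obtain ⟨η, hη, hηd⟩ := exists_isSmall a b c hd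
    refine not_isCenter_of_isOneSided hη (Or.inl (hη.isOneSided_of_oddPart (q := q) ?_)) hcen
    intro x hx hx0
    exact hball (by rw [Real.dist_0_eq_abs]; linarith) hx0
  · obtain ⟨d, hd, hball⟩ := Metric.eventually_nhds_iff.1 h
    obtain ⟨η, hη, hηd⟩ := exists_isSmall a b c hd
    refine not_isCenter_of_isOneSided hη
      (Or.inr (hη.neg_left.neg_right.isOneSided_of_oddPart (q := q) ?_)) hcen
    intro x hx hx0
    have := hball (y := -x) (by rw [Real.dist_0_eq_abs, abs_neg]; linarith) (neg_ne_zero.2 hx0)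
    rw [← oddPart_neg_neg, neg_neg] at this
    linarith

/-- A bounded Lipschitz vector field has complete solutions. -/
theorem exists_complete_solution {E : Type*} [NormedAddCommGroup E] [NormedSpace ℝ E]
    [CompleteSpace E] {V : E → E} {K L : NNReal} (hK : LipschitzWith K V)
    (hL : ∀ z, ‖V z‖ ≤ L) (z₀ : E) :
    ∃ γ : ℝ → E, γ 0 = z₀ ∧ ∀ t, HasDerivAt γ (V (γ t)) t := by
  have hloc : ∀ n : ℕ, ∃ α : ℝ → E, α 0 = z₀ ∧
      ∀ t ∈ Set.Ioo (-(n + 1 : ℝ)) (n + 1), HasDerivAt α (V (α t)) t := by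
    intro n
    have h0 : (0 : ℝ) ∈ Set.Icc (-(n + 1 : ℝ)) (n + 1) :=
      ⟨by linarith [n.cast_nonneg (α := ℝ)], by positivity⟩
    have hp : IsPicardLindelof (fun _ => V) (⟨0, h0⟩ : Set.Icc (-(n + 1 : ℝ)) (n + 1)) z₀
        (L * (n + 1)) 0 L K := by
      refine .of_time_independent (fun z _ => hL z) hK.lipschitzOnWith ?_
      simp
    obtain ⟨α, h1, h2⟩ := hp.exists_eq_forall_mem_Icc_hasDerivWithinAt₀
    exact ⟨α, h1, fun t ht =>
      (h2 t (Set.Ioo_subset_Icc_self ht)).hasDerivAt (Icc_mem_nhds ht.1 ht.2)⟩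
  choose α h0 hα using hloc
  have agree : ∀ m n : ℕ, m ≤ n → ∀ t ∈ Set.Ioo (-(m + 1 : ℝ)) (m + 1), α m t = α n t := by
    intro m n hmn
    have hc : (m : ℝ) ≤ n := Nat.cast_le.2 hmn
    have hm : (0 : ℝ) ≤ m := m.cast_nonneg
    exact ODE_solution_unique_of_mem_Ioo (v := fun _ => V) (s := fun _ => Set.univ) (t₀ := 0)
      (fun _ _ => hK.lipschitzOnWith) ⟨by linarith, by linarith⟩
      (fun t ht => ⟨hα m t ht, trivial⟩)
      (fun t ht => ⟨hα n t ⟨by linarith [ht.1], by linarith [ht.2]⟩, trivial⟩)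
      ((h0 m).trans (h0 n).symm)
  have mem : ∀ t : ℝ, t ∈ Set.Ioo (-((⌈|t|⌉₊ : ℕ) + 1 : ℝ)) ((⌈|t|⌉₊ : ℕ) + 1) := fun t => by
    have := Nat.le_ceil |t|
    exact abs_lt.1 (by linarith)
  have heq : ∀ (n : ℕ), ∀ t ∈ Set.Ioo (-(n + 1 : ℝ)) (n + 1), α ⌈|t|⌉₊ t = α n t := by
    intro n t ht
    rcases le_total ⌈|t|⌉₊ n with h | h
    · exact agree _ _ h t (mem t)
    · exact (agree _ _ h t ht).symm
  refine ⟨fun t => α ⌈|t|⌉₊ t, h0 _, fun t => ?_⟩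
  refine (hα _ t (mem t)).congr_of_eventuallyEq ?_
  filter_upwards [Ioo_mem_nhds (mem t).1 (mem t).2] with s hs
  exact heq _ s hs

/-- The Liénard vector field, cut off outside the unit square. -/
noncomputable def cutoffField (a b c : ℝ) (z : ℝ × ℝ) : ℝ × ℝ :=
  (fun z : ℝ × ℝ => (damping b c z.1 - z.2, force a z.1))
    ((Set.projIcc (-1 : ℝ) 1 (by norm_num) z.1 : ℝ),
      (Set.projIcc (-1 : ℝ) 1 (by norm_num) z.2 : ℝ))

theorem cutoffField_eq (a b c : ℝ) {z : ℝ × ℝ} (h1 : |z.1| ≤ 1) (h2 : |z.2| ≤ 1) :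
    cutoffField a b c z = (damping b c z.1 - z.2, force a z.1) := by
  unfold cutoffField
  rw [Set.projIcc_of_mem (by norm_num) (abs_le.1 h1 : z.1 ∈ Set.Icc (-1 : ℝ) 1),
    Set.projIcc_of_mem (by norm_num) (abs_le.1 h2 : z.2 ∈ Set.Icc (-1 : ℝ) 1)]

theorem cutoffField_regular (a b c : ℝ) :
    ∃ K L : NNReal, LipschitzWith K (cutoffField a b c) ∧ ∀ z, ‖cutoffField a b c z‖ ≤ L := by
  set W : ℝ × ℝ → ℝ × ℝ := fun z => (damping b c z.1 - z.2, force a z.1) with hW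
  set Q : Set (ℝ × ℝ) := Set.Icc (-1) 1 ×ˢ Set.Icc (-1) 1 with hQ
  set π : ℝ × ℝ → ℝ × ℝ := fun z => ((Set.projIcc (-1 : ℝ) 1 (by norm_num) z.1 : ℝ),
      (Set.projIcc (-1 : ℝ) 1 (by norm_num) z.2 : ℝ)) with hπ
  have cW : ContDiff ℝ 1 W := by
    unfold W damping force
    fun_prop
  have cQ : IsCompact Q := isCompact_Icc.prod isCompact_Icc
  have hπQ : ∀ z, π z ∈ Q := fun z => ⟨Subtype.coe_prop _, Subtype.coe_prop _⟩
  have hp : LipschitzWith 1 fun u : ℝ =>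
      ((Set.projIcc (-1 : ℝ) 1 (by norm_num) u : Set.Icc (-1 : ℝ) 1) : ℝ) := by
    have := (LipschitzWith.subtype_val (Set.Icc (-1 : ℝ) 1)).comp
      (LipschitzWith.projIcc (by norm_num : (-1 : ℝ) ≤ 1))
    rw [mul_one] at this
    exact this
  have lπ : LipschitzWith 1 π := by
    simpa using (hp.comp LipschitzWith.prod_fst).prodMk (hp.comp LipschitzWith.prod_snd)
  obtain ⟨K, hK⟩ := cW.contDiffOn.exists_lipschitzOnWith one_ne_zero
    ((convex_Icc (-1 : ℝ) 1).prod (convex_Icc (-1 : ℝ) 1)) cQ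
  obtain ⟨L, hL⟩ := cQ.exists_bound_of_continuousOn cW.continuous.continuousOn
  refine ⟨K, L.toNNReal, ?_, fun z => (hL _ (hπQ z)).trans (Real.le_coe_toNNReal L)⟩
  have := hK.comp (lπ.lipschitzOnWith (s := Set.univ)) fun z _ => hπQ z
  rw [mul_one, lipschitzOnWith_univ] at this
  exact this

/-- In the Hamiltonian and the reversible case the damping is controlled by the potential. -/
theorem IsSmall.force_mul_damping_sub_le {a b η : ℝ} (hη : IsSmall a b 0 η) (hab : a * b = 0)
    {X Y : ℝ} (hX : 0 < X) (hXη : X ≤ η) :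
    force a X * (damping b 0 X - damping b 0 Y) ≤
      2 * |b| * |potential a X - potential a Y| := by
  rcases mul_eq_zero.1 hab with rfl | rfl
  · have hX1 : X ≤ 1 := hXη.trans hη.le_one
    have e1 : force 0 X * (damping b 0 X - damping b 0 Y) =
        b / 4 * (X ^ 2 - Y ^ 2) * (X ^ 5 * (X ^ 2 + Y ^ 2)) := by
      unfold force damping; ring
    have e2 : potential 0 X - potential 0 Y =
        (X ^ 2 - Y ^ 2) * (X ^ 4 + X ^ 2 * Y ^ 2 + Y ^ 4) / 6 := by
      unfold potential; ring
    have h1 : X ^ 5 * (X ^ 2 + Y ^ 2) ≤ X ^ 4 + X ^ 2 * Y ^ 2 + Y ^ 4 := by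
      have h2 : X ^ 5 ≤ X ^ 2 := pow_le_pow_of_le_one hX.le hX1 (by norm_num)
      nlinarith [mul_le_mul_of_nonneg_right h2 (by positivity : 0 ≤ X ^ 2 + Y ^ 2),
        sq_nonneg (Y ^ 2)]
    rw [e1, e2, abs_div, abs_mul, abs_of_pos (by positivity : 0 < X ^ 4 + X ^ 2 * Y ^ 2 + Y ^ 4),
      abs_of_pos (by norm_num : (0 : ℝ) < 6)]
    have h3 : 0 ≤ |b| * |X ^ 2 - Y ^ 2| := by positivity
    calc b / 4 * (X ^ 2 - Y ^ 2) * (X ^ 5 * (X ^ 2 + Y ^ 2))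
        ≤ |b| * |X ^ 2 - Y ^ 2| / 4 * (X ^ 5 * (X ^ 2 + Y ^ 2)) := by
          refine mul_le_mul_of_nonneg_right ?_ (by positivity)
          have := le_abs_self (b * (X ^ 2 - Y ^ 2))
          rw [abs_mul] at this
          linarith
      _ ≤ |b| * |X ^ 2 - Y ^ 2| / 4 * (X ^ 4 + X ^ 2 * Y ^ 2 + Y ^ 4) :=
          mul_le_mul_of_nonneg_left h1 (by positivity)
      _ ≤ |b| * |X ^ 2 - Y ^ 2| / 3 * (X ^ 4 + X ^ 2 * Y ^ 2 + Y ^ 4) :=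
          mul_le_mul_of_nonneg_right (by linarith) (by positivity)
      _ = _ := by ring
  · simp [damping]

/-- In the Hamiltonian and the reversible case one turn closes up. -/
theorem IsLienardOn.turn_closes {a b η : ℝ} {x w : ℝ → ℝ} (h : IsLienardOn a b 0 η x w)
    (hη : IsSmall a b 0 η) (hab : a * b = 0) {t₀ t₁ t₂ : ℝ} (h01 : t₀ < t₁) (h12 : t₁ < t₂)
    (hbox : ∀ t ∈ Set.Icc t₀ t₂, |x t| ≤ η ∧ |w t| ≤ η)
    (hR : ∀ t ∈ Set.Ioo t₀ t₁, 0 < x t) (hL : ∀ t ∈ Set.Ioo t₁ t₂, x t < 0)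
    (hx0 : x t₀ = 0) (hx2 : x t₂ = 0) : w t₂ = w t₀ := by
  rcases le_total (w t₂) (w t₀) with hle | hle
  · exact (h.comparison hη h01 h12 hbox hR hL hx0 hle
      fun X Y h1 h2 _ _ => hη.force_mul_damping_sub_le hab h1 h2).1
  · have hr := h.reflect
    have hηr := hη.neg_left
    rw [neg_zero] at hr
    have := (hr.comparison hηr (t₀ := -t₂) (t₁ := -t₁) (t₂ := -t₀) (neg_lt_neg h12)
      (neg_lt_neg h01)
      (fun t ht => by
        rw [abs_neg]
        exact hbox (-t) ⟨by linarith [ht.2], by linarith [ht.1]⟩)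
      (fun t ht => neg_pos.2 (hL (-t) ⟨by linarith [ht.2], by linarith [ht.1]⟩))
      (fun t ht => neg_lt_zero.2 (hR (-t) ⟨by linarith [ht.2], by linarith [ht.1]⟩))
      (by simp only [neg_neg, hx2, neg_zero]) (by simpa only [neg_neg] using hle)
      (fun X Y h1 h2 _ _ =>
        hηr.force_mul_damping_sub_le (by rw [neg_mul, hab, neg_zero]) h1 h2)).1
    simpa only [neg_neg] using this.symm

/-- Small solutions reach the negative vertical axis. -/
theorem IsLienardOn.exists_reach {a b c η : ℝ} {x w : ℝ → ℝ} (h : IsLienardOn a b c η x w)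
    (hη : IsSmall a b c η) {r t₀ : ℝ} (hr : 0 < r) (hrη : r ≤ η / 16) (hx : |x t₀| ≤ η)
    (hE : energy a (x t₀) (w t₀) = r ^ 6) :
    ∃ t₁ s, x t₁ = 0 ∧ w t₁ < 0 ∧ 0 < s ∧ s ≤ η / 8 ∧ energy a (x t₁) (w t₁) = s ^ 6 := by
  have hη0 := hη.pos
  have root : ∀ e, 0 < e → e ≤ 4 * r ^ 6 → ∃ s : ℝ, 0 < s ∧ s ≤ 2 * r ∧ s ^ 6 = e := by
    intro e he her
    refine ⟨e ^ (1 / 6 : ℝ), Real.rpow_pos_of_pos he _, ?_, ?_⟩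
    · refine (pow_le_pow_iff_left₀ (Real.rpow_nonneg he.le _) (by positivity)
        (by norm_num : 6 ≠ 0)).1 ?_
      rw [← Real.rpow_natCast, ← Real.rpow_mul he.le, mul_pow]
      norm_num
      nlinarith [pow_pos hr 6]
    · rw [← Real.rpow_natCast, ← Real.rpow_mul he.le]
      norm_num
  have hr6 : 0 < r ^ 6 := by positivity
  have hleft : ∀ t r', 0 < r' → r' ≤ 2 * r → r' ^ 6 ≤ 2 * r ^ 6 → |x t| ≤ η →
      energy a (x t) (w t) = r' ^ 6 → (x t < 0 ∨ x t = 0 ∧ 0 < w t) →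
      ∃ t₁ s, x t₁ = 0 ∧ w t₁ < 0 ∧ 0 < s ∧ s ≤ η / 8 ∧
        energy a (x t₁) (w t₁) = s ^ 6 := by
    intro t r' hr' hr'r hr'6 hxt hEt ht
    obtain ⟨t₁, h1, _, h3, h4, h5⟩ := h.exists_left_arc hη hr' (by linarith) hxt hEt ht
    obtain ⟨_, _, k3, k4⟩ := h5 t₁ (Set.right_mem_Icc.2 h1.le)
    obtain ⟨s, s1, s2, s3⟩ := root _ (lt_of_lt_of_le (by positivity) k3) (by linarith)
    exact ⟨t₁, s, h3, h4, s1, by linarith, s3.symm⟩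
  have hright : (0 < x t₀ ∨ x t₀ = 0 ∧ w t₀ < 0) →
      ∃ t₁ s, x t₁ = 0 ∧ w t₁ < 0 ∧ 0 < s ∧ s ≤ η / 8 ∧
        energy a (x t₁) (w t₁) = s ^ 6 := by
    intro ht
    obtain ⟨t₁, h1, _, h3, h4, h5⟩ := h.exists_right_arc hη hr (by linarith) hx hE ht
    obtain ⟨k1, _, k3, k4⟩ := h5 t₁ (Set.right_mem_Icc.2 h1.le)
    obtain ⟨s, s1, s2, s3⟩ := root _ (lt_of_lt_of_le (by positivity) k3) (by linarith)
    exact hleft t₁ s s1 s2 (by linarith) k1 s3.symm (Or.inr ⟨h3, h4⟩)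
  rcases lt_trichotomy (x t₀) 0 with h1 | h1 | h1
  · exact hleft t₀ r hr (by linarith) (by linarith) hx hE (Or.inl h1)
  · rcases lt_trichotomy (w t₀) 0 with h2 | h2 | h2
    · exact hright (Or.inr ⟨h1, h2⟩)
    · rw [h1, h2, energy_zero_left] at hE
      nlinarith
    · exact hleft t₀ r hr (by linarith) (by linarith) hx hE (Or.inr ⟨h1, h2⟩)
  · exact hright (Or.inl h1)

/-- In the Hamiltonian and the reversible case, small nonzero points lie on periodic orbits. -/
theorem exists_periodicOrbit {a b η : ℝ} (hη : IsSmall a b 0 η) (hab : a * b = 0)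
    {q : ℝ × ℝ} (hq : q ≠ 0) (hq1 : |q.1| ≤ η)
    (hqE : energy a q.1 (q.2 + damping b 0 q.1) ≤ (η / 16) ^ 6) :
    ∃ γ : ℝ → ℝ × ℝ, γ 0 = q ∧ IsPeriodicOrbit (quinticSystem a b 0) γ ∧ ∀ t, γ t ≠ 0 := by
  have hη0 := hη.pos
  obtain ⟨K, L, hK, hL⟩ := cutoffField_regular a b 0
  obtain ⟨z, hz0, hz⟩ := exists_complete_solution hK hL (q.1, q.2 + damping b 0 q.1)
  have cz : Continuous z := continuous_iff_continuousAt.2 fun t => (hz t).continuousAt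
  have inbox : ∀ t, |(z t).1| ≤ η → |(z t).2| ≤ η →
      HasDerivAt z (damping b 0 (z t).1 - (z t).2, force a (z t).1) t := by
    intro t h1 h2
    rw [← cutoffField_eq a b 0 (h1.trans hη.le_one) (h2.trans hη.le_one)]
    exact hz t
  have h : IsLienardOn a b 0 η (fun t => (z t).1) (fun t => (z t).2) :=
    ⟨cz.fst, cz.snd, fun t h1 h2 => (inbox t h1 h2).fst, fun t h1 h2 => (inbox t h1 h2).snd⟩
  have hEpos : 0 < energy a q.1 (q.2 + damping b 0 q.1) := by
    have hge := hη.potential_ge hq1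
    unfold energy
    by_cases h1 : q.1 = 0
    · rw [h1, damping_zero, potential_zero, add_zero, add_zero]
      have h2 : q.2 ≠ 0 := fun h2 => hq (Prod.ext h1 h2)
      positivity
    · have : 0 < q.1 ^ 6 := by positivity
      have := sq_nonneg (q.2 + damping b 0 q.1)
      linarith
  set e := energy a q.1 (q.2 + damping b 0 q.1) with he
  have hr6 : (e ^ (1 / 6 : ℝ)) ^ 6 = e := by
    rw [← Real.rpow_natCast, ← Real.rpow_mul hEpos.le]
    norm_num
  have hr0 : 0 < e ^ (1 / 6 : ℝ) := Real.rpow_pos_of_pos hEpos _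
  obtain ⟨t₀, s, hx0, hw0, hs0, hsη, hEs⟩ := h.exists_reach hη (t₀ := 0) hr0
    ((pow_le_pow_iff_left₀ hr0.le (by positivity) (by norm_num : 6 ≠ 0)).1 (by rwa [hr6]))
    (by rw [hz0]; exact hq1) (by rw [hr6, hz0])
  obtain ⟨t₁, t₂, h01, h12, hR, hL', _, hx2, _, hb⟩ := h.exists_turn hη hs0 hsη hx0 hw0 hEs
  have hw : (z t₂).2 = (z t₀).2 := h.turn_closes hη hab h01 h12
    (fun t ht => ⟨(hb t ht).1, (hb t ht).2.1⟩) hR hL' hx0 hx2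
  have hT : 0 < t₂ - t₀ := by linarith
  have hper : Function.Periodic z (t₂ - t₀) := by
    have : (fun t => z (t + (t₂ - t₀))) = z :=
      ODE_solution_unique_univ (v := fun _ => cutoffField a b 0) (s := fun _ => Set.univ)
        (K := K) (t₀ := t₀) (fun _ => hK.lipschitzOnWith)
        (fun t => ⟨(hz (t + (t₂ - t₀))).comp_add_const t _, trivial⟩)
        (fun t => ⟨hz t, trivial⟩)
        (by
          rw [add_sub_cancel]
          exact Prod.ext (hx2.trans hx0.symm) hw)
    exact fun t => congrFun this t
  have hall : ∀ t, |(z t).1| ≤ η ∧ |(z t).2| ≤ η ∧ 0 < energy a (z t).1 (z t).2 := by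
    intro t
    obtain ⟨u, hu, hue⟩ := hper.exists_mem_Ico hT t t₀
    rw [hue]
    exact hb u ⟨hu.1, by linarith [hu.2]⟩
  refine ⟨fun t => ((z t).1, (z t).2 - damping b 0 (z t).1), ?_, ⟨fun t => ?_, ?_,
    t₂ - t₀, hT, fun t => ?_⟩, fun t ht => ?_⟩
  · simp only [hz0, add_sub_cancel_right]
  · obtain ⟨k1, k2, _⟩ := hall t
    have d1 := h.derivX t k1 k2
    have d2 := h.derivW t k1 k2
    have := d1.prodMk (d2.sub ((hasDerivAt_damping b 0 (z t).1).comp t d1))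
    refine this.congr_deriv (Prod.ext ?_ ?_)
    · simp [quinticSystem]
    · simp only [quinticSystem, force]
      ring
  · by_contra! hconst
    have hx : ∀ t, (z t).1 = (z 0).1 := fun t => (Prod.mk.inj (hconst t)).1
    have hpos := hR ((t₀ + t₁) / 2) ⟨by linarith, by linarith⟩
    have hzero : (z 0).1 = 0 := (hx t₀).symm.trans hx0
    simp only [hx, hzero, lt_irrefl] at hpos
  · simp only [hper t]
  · obtain ⟨_, _, k3⟩ := hall t
    have e1 : (z t).1 = 0 := congrArg Prod.fst ht
    have e2 : (z t).2 - damping b 0 (z t).1 = 0 := congrArg Prod.snd ht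
    rw [e1, damping_zero, sub_zero] at e2
    rw [e1, e2, energy_zero_left] at k3
    norm_num at k3

theorem isCenter_of_eq_zero {a b : ℝ} (hab : a * b = 0) :
    IsCenter (quinticSystem a b 0) (0, 0) := by
  obtain ⟨η, hη, -⟩ := exists_isSmall a b 0 one_pos
  have hη0 := hη.pos
  refine ⟨by simp [quinticSystem], {q | q = 0 ∨ ∃ γ : ℝ → ℝ × ℝ, γ 0 = q ∧
    IsPeriodicOrbit (quinticSystem a b 0) γ ∧ ∀ t, γ t ≠ 0}, ?_, ?_⟩
  · have c1 : Continuous fun q : ℝ × ℝ => |q.1| := by fun_prop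
    have c2 : Continuous fun q : ℝ × ℝ => energy a q.1 (q.2 + damping b 0 q.1) := by
      unfold energy potential damping
      fun_prop
    have t1 : Tendsto (fun q : ℝ × ℝ => |q.1|) (𝓝 (0, 0)) (𝓝 0) := by
      simpa using c1.tendsto (0, 0)
    have t2 : Tendsto (fun q : ℝ × ℝ => energy a q.1 (q.2 + damping b 0 q.1)) (𝓝 (0, 0))
        (𝓝 0) := by
      simpa [energy_zero_left, damping_zero] using c2.tendsto (0, 0)
    filter_upwards [t1.eventually (gt_mem_nhds hη0),
      t2.eventually (gt_mem_nhds (by positivity : 0 < (η / 16) ^ 6))] with q h1 h2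
    by_cases hq : q = 0
    · exact Or.inl hq
    · exact Or.inr (exists_periodicOrbit hη hab hq h1.le h2.le)
  · rintro q ⟨rfl | ⟨γ, hγ0, hγ, hne⟩, hq0⟩
    · exact absurd rfl hq0
    · refine ⟨γ, hγ0, hγ, fun t => ⟨Or.inr ⟨fun s => γ (s + t), by simp, ⟨?_, ?_, ?_⟩,
        fun s => hne _⟩, fun hmem => hne t hmem⟩⟩
      · exact fun s => (hγ.1 (s + t)).comp_add_const s t
      · by_contra! hconst
        obtain ⟨u, hu⟩ := hγ.2.1
        have e1 := hconst (u - t)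
        have e2 := hconst (-t)
        simp only [sub_add_cancel, neg_add_cancel, zero_add] at e1 e2
        exact hu (e1.trans e2.symm)
      · obtain ⟨T, hT, hp⟩ := hγ.2.2
        refine ⟨T, hT, fun s => ?_⟩
        change γ (s + T + t) = γ (s + t)
        rw [add_right_comm]
        exact hp (s + t)

theorem hasNilpotentForm_quinticSystem (a b c : ℝ) :
    HasNilpotentForm (quinticSystem a b c) (0, 0) := by
  refine ⟨AffineEquiv.refl ℝ _, -1, fun _ => 0, fun z => -(z.1 ^ 5 + a * z.1 ^ 6 +
    z.2 * (b * z.1 ^ 3 + c * z.1 ^ 4)), rfl, by norm_num,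
    ⟨analyticAt_const, rfl, by simp⟩, ⟨?_, by simp, ?_⟩, Eventually.of_forall fun z => ?_⟩
  · have h1 : AnalyticAt ℝ (fun z : ℝ × ℝ => z.1) 0 := analyticAt_fst
    have h2 : AnalyticAt ℝ (fun z : ℝ × ℝ => z.2) 0 := analyticAt_snd
    fun_prop
  · have h1 : HasFDerivAt (fun z : ℝ × ℝ => z.1) (ContinuousLinearMap.fst ℝ ℝ ℝ) 0 :=
      hasFDerivAt_fst
    have h2 : HasFDerivAt (fun z : ℝ × ℝ => z.2) (ContinuousLinearMap.snd ℝ ℝ ℝ) 0 :=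
      hasFDerivAt_snd
    have := ((((h1.pow 5).add ((h1.pow 6).const_mul a)).add
      (h2.mul (((h1.pow 3).const_mul b).add ((h1.pow 4).const_mul c)))).neg)
    refine HasFDerivAt.fderiv (this.congr_fderiv ?_)
    simp
  · simp [quinticSystem]

end PlanarSystem

theorem mainTheorem7 (a b c : ℝ) :
    PlanarSystem.IsNilpotentCenter (PlanarSystem.quinticSystem a b c) (0, 0) ↔
      a * b = 0 ∧ c = 0 := by
  constructor
  · exact fun h => PlanarSystem.eq_zero_of_isCenter h.1
  · rintro ⟨hab, rfl⟩
    exact ⟨PlanarSystem.isCenter_of_eq_zero hab,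
      PlanarSystem.hasNilpotentForm_quinticSystem a b 0⟩
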